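/- **Setting.** Fix $\overline T<\infty$ and a filtered probability space $(\Omega,\mathcal F,(\mathcal F_t)_{t\in[0,\overline T]},\mathbb Q)$. Under $\mathbb Q$, let $J=(J_t)_{t\in[0,\overline T]}$ be a continuous-time Markov chain relative to $(\mathcal F_t)$ with state space $S=\{1,\dots,n\}$, right-continuous paths with left limits, and irreducible generator matrix $\mathbf G=(g_{i,j})$; that is, $g_{i,j}\ge 0$ for $i\ne j$, $\sum_j g_{i,j}=0$, and $\mathbb Q(J_t=j\mid\mathcal F_s)=(e^{(t-s)\mathbf G})_{J_s,j}$ for $s\le t\le\overline T$. Let $r:S\to[0,\infty)$, let $r(J_t)$ be the short rate, and let $\mathbf R=\operatorname{diag}(r(1),\dots,r(n))$. $\mathbb Q$ is the market's pricing measure for the money market account as numéraire: the value at time $0$ of a claim paying the $\mathcal F_T$-measurable amount $X\ge 0$ at time $T\le\overline T$ is $\mathbb E^{\mathbb Q}[e^{-\int_0^T r(J_s)\,ds}X]$. A *real-world measure* is a probability measure $\mathbb P$, equivalent to $\mathbb Q$ on $\mathcal F_{\overline T}$, under which the market has a transition independent pricing kernel: there are a constant $\delta\in\mathbb R$ and a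 function $h:S\to(0,\infty)$ such that, for all $T\le\overline T$ and all $\mathcal F_T$-measurable $X\ge 0$, $$\mathbb E^{\mathbb Q}\Big[e^{-\int_0^T r(J_s)\,ds}X\Big]=\mathbb E^{\mathbb P}\Big[e^{-\delta T}\frac{h(J_T)}{h(J_0)}X\Big].$$ **Proposition.** Suppose that $(\mathbf G-\mathbf R)\pi=\rho\pi$ for some $\rho<0$ and some vector $\pi$ with $\pi(i)>0$ for all $i\in S$. Then the real-world measure exists and is unique on $\mathcal F_{\overline T}$: the measure with density $Z_{\overline T}$ with respect to $\mathbb Q$ is a real-world measure, and every real-world measure $\mathbb P$ satisfies, for every $T\in[0,\overline T]$, $$\frac{d\mathbb P}{d\mathbb Q}\Big|_{\mathcal F_T}=Z_T:=e^{-\int_0^T r(J_s)\,ds-\rho T}\,\frac{\pi(J_T)}{\pi(J_0)} .$$ Under $\mathbb P$, $J$ is a continuous-time Markov chain relative to $(\mathcal F_t)_{t\in[0,\overline T]}$ with generator matrix $\mathbf G^\pi=(g^\pi_{i,j})$, where $$g^\pi_{i,j}=\frac{\pi(j)}{\pi(i)}\,g_{i,j}\quad(i\ne j),\qquad g^\pi_{i,i}=-\sum_{j\ne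 i}g^\pi_{i,j},$$ and $\mathbf G^\pi$ is again an irreducible generator matrix. -/

import Mathlib

open MeasureTheory
open scoped NNReal ENNReal Matrix Topology

/-- `G` is a generator (rate) matrix: off-diagonal entries are non-negative, rows sum to zero. -/
structure IsGeneratorMatrix {n : ℕ} (G : Matrix (Fin n) (Fin n) ℝ) : Prop where
  nonneg_off_diag : ∀ i j, i ≠ j → 0 ≤ G i j
  row_sum : ∀ i, ∑ j, G i j = 0

/-- Irreducibility of a chain with generator `G`: every state is reached from every state by
transitions of positive rate. On a finite state space an irreducible chain is automatically
positive recurrent. -/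
def IsIrreducibleGenerator {n : ℕ} (G : Matrix (Fin n) (Fin n) ℝ) : Prop :=
  ∀ i j, Relation.ReflTransGen (fun a b => 0 < G a b) i j

/-- Under the measure `μ`, the process `(J t)` for `t ∈ [0, Tb]` is a continuous-time Markov
chain relative to the filtration `F`, with generator matrix `G`: it is adapted, its paths are
right-continuous with left limits (for the discrete topology on the state space), and its
transition probabilities are given by the matrix exponential of `G`. -/
structure IsCTMC {Ω : Type*} {m : MeasurableSpace Ω} (F : Filtration ℝ≥0 m) (μ : Measure Ω)
    (Tb : ℝ≥0) {n : ℕ} (G : Matrix (Fin n) (Fin n) ℝ) (J : ℝ≥0 → Ω → Fin n) : Prop where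
  adapted : ∀ t ≤ Tb, Measurable[F t] (J t)
  right_cont : ∀ ω, ∀ t < Tb, ∀ᶠ s in 𝓝[>] t, J s ω = J t ω
  left_lim : ∀ ω, ∀ t ≤ Tb, 0 < t → ∃ j, ∀ᶠ s in 𝓝[<] t, J s ω = j
  transition : ∀ s t, s ≤ t → t ≤ Tb → ∀ j,
    μ[(J t ⁻¹' {j}).indicator (fun _ => (1 : ℝ)) | F s]
      =ᵐ[μ] fun ω => NormedSpace.exp (((t : ℝ) - (s : ℝ)) • G) (J s ω) j

/-- The discount factor `M_0 / M_t = exp (-∫₀ᵗ r(J_s) ds)` of the money market account `M`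
with short rate `r(J_t)`. -/
noncomputable def discount {Ω : Type*} {n : ℕ} (r : Fin n → ℝ) (J : ℝ≥0 → Ω → Fin n)
    (t : ℝ≥0) (ω : Ω) : ℝ :=
  Real.exp (-∫ s in (0 : ℝ)..(t : ℝ), r (J s.toNNReal ω))

/-- `S` is the pricing kernel under `P` of the market whose pricing measure, for the money
market account as numéraire, is `Q`: `S` is a positive adapted process with `S_0 = 1`, and the
value `E^Q[(M_0 / M_T) X]` of every claim that pays an `F_T`-measurable amount `X ≥ 0` at time
`T` is `E^P[S_T X]`. -/
structure IsPricingKernel {Ω : Type*} {m : MeasurableSpace Ω} (F : Filtration ℝ≥0 m)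
    (Tb : ℝ≥0) (Q P : Measure Ω) {n : ℕ} (r : Fin n → ℝ) (J : ℝ≥0 → Ω → Fin n)
    (S : ℝ≥0 → Ω → ℝ) : Prop where
  adapted : ∀ t ≤ Tb, Measurable[F t] (S t)
  pos : ∀ t ≤ Tb, ∀ ω, 0 < S t ω
  initial : ∀ ω, S 0 ω = 1
  price : ∀ T ≤ Tb, ∀ X : Ω → ℝ≥0∞, Measurable[F T] X →
    ∫⁻ ω, ENNReal.ofReal (discount r J T ω) * X ω ∂Q
      = ∫⁻ ω, ENNReal.ofReal (S T ω) * X ω ∂P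

/-- `P` is a real-world measure in the sense of Ross recovery: a probability measure, equivalent
to `Q` on `F_Tb`, under which the pricing kernel is transition independent, i.e. of the form
`exp (-δ t) h(J_t) / h(J_0)` for some constant `δ` and some positive function `h`. -/
structure IsRealWorldMeasure {Ω : Type*} {m : MeasurableSpace Ω} (F : Filtration ℝ≥0 m)
    (Tb : ℝ≥0) (Q P : Measure Ω) {n : ℕ} (r : Fin n → ℝ) (J : ℝ≥0 → Ω → Fin n) : Prop where
  isProbability : IsProbabilityMeasure P
  equivalent : ∀ A, MeasurableSet[F Tb] A → (P A = 0 ↔ Q A = 0)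
  transition_independent : ∃ (δ : ℝ) (h : Fin n → ℝ), (∀ i, 0 < h i) ∧
    IsPricingKernel F Tb Q P r J
      (fun t ω => Real.exp (-δ * t) * (h (J t ω) / h (J 0 ω)))

/-- `Z` is the density of `P` with respect to `Q` on the sub-σ-algebra `F_T`. -/
def HasDensityOn {Ω : Type*} {m : MeasurableSpace Ω} (F : Filtration ℝ≥0 m) (T : ℝ≥0)
    (Q P : Measure Ω) (Z : Ω → ℝ) : Prop :=
  Measurable[F T] Z ∧
    ∀ A, MeasurableSet[F T] A → P A = ∫⁻ ω in A, ENNReal.ofReal (Z ω) ∂Q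

/-- `Z_T = exp (-∫₀ᵀ r(J_s) ds - ρ T) π(J_T) / π(J_0)`. -/
noncomputable def recoveryDensity {Ω : Type*} {n : ℕ} (r : Fin n → ℝ) (J : ℝ≥0 → Ω → Fin n)
    (ρ : ℝ) (π : Fin n → ℝ) (T : ℝ≥0) (ω : Ω) : ℝ :=
  Real.exp (-(∫ s in (0 : ℝ)..(T : ℝ), r (J s.toNNReal ω)) - ρ * T) * (π (J T ω) / π (J 0 ω))

/-- The matrix with entries `(π(j) / π(i)) g_{ij}` off the diagonal and with the diagonal
entries that make each row sum to zero. -/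
noncomputable def recoveredGenerator {n : ℕ} (G : Matrix (Fin n) (Fin n) ℝ) (π : Fin n → ℝ) :
    Matrix (Fin n) (Fin n) ℝ :=
  Matrix.of fun i j =>
    if i = j then -∑ k ∈ Finset.univ.erase i, π k / π i * G i k else π j / π i * G i j

/-! Write D for the discount factor and R for the diagonal matrix of `r`. Paying `1_A / S_T` in the
pricing identity shows that a kernel `S_T = e^{-δT} h(J_T)/h(J_0)` forces dP/dQ on F_T to be D_T /
S_T, which is `recoveryDensity` for the pair c = -δ, f = 1/h (`IsPricingKernel.hasDensityOn`). It
remains to find the pairs (c, f) for which these densities come from one measure.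

The Feynman–Kac formula `IsCTMC.feynman_kac` reduces this to linear algebra: E[D_t f(J_t) | F_s] =
D_s (e^{(t-s)(G-R)} f)(J_s). Consistency in time thus means e^{u(G-R)} f = e^{cu} f at every state
that J_s charges. An irreducible chain charges every state at interior times, so differentiating at
u = 0 gives (G-R) f = c f. By Perron–Frobenius the positive eigenpair is (ρ, π) up to scaling, and
the scale cancels in π(J_T)/π(J_0). Conversely, the eigenvector equation makes Z a martingale, which
gives existence.

For the law of J under P, the same formula applied to π · 1_j gives transition probabilities e^{-ρu}
(π(j)/π(i)) (e^{u(G-R)})_{ij}. These are the entries of e^{uG^π}, because G^π = diag(π)⁻¹ (G-R)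
diag(π) - ρ. -/

/-! ### Variation of constants in a Banach algebra -/

section BanachAlgebra

variable {𝔸 : Type*} [NormedRing 𝔸] [NormedAlgebra ℝ 𝔸] [CompleteSpace 𝔸]

theorem exp_add_smul (x : 𝔸) (a b : ℝ) :
    NormedSpace.exp ((a + b) • x) = NormedSpace.exp (a • x) * NormedSpace.exp (b • x) := by
  let _ : NormedAlgebra ℚ 𝔸 := NormedAlgebra.restrictScalars ℚ ℝ 𝔸
  rw [add_smul]
  exact NormedSpace.exp_add_of_commute (((Commute.refl x).smul_left a).smul_right b)

theorem hasDerivAt_exp_sub_const_smul (x : 𝔸) (a t : ℝ) :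
    HasDerivAt (fun u : ℝ => NormedSpace.exp ((u - a) • x))
      (x * NormedSpace.exp ((t - a) • x)) t :=
  HasDerivAt.comp_sub_const t a (hasDerivAt_exp_smul_const' x (t - a))

theorem hasDerivAt_exp_const_sub_smul (x : 𝔸) (a t : ℝ) :
    HasDerivAt (fun u : ℝ => NormedSpace.exp ((a - u) • x))
      (-(x * NormedSpace.exp ((a - t) • x))) t :=
  HasDerivAt.comp_const_sub a t (hasDerivAt_exp_smul_const' x (a - t))

/-- The variation-of-constants equation `V = V(a) e^{(t-a)G} - ∫ V R e^{(t-u)G} du` has the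
solution `V(a) e^{(t-a)(G-R)}` only. -/
theorem eq_exp_of_variation_of_constants {V : ℝ → 𝔸} {G R : 𝔸} {a b : ℝ}
    (hint : IntervalIntegrable V volume a b)
    (hV : ∀ t ∈ Set.Icc a b, V t = V a * NormedSpace.exp ((t - a) • G)
      - ∫ u in a..t, V u * R * NormedSpace.exp ((t - u) • G)) :
    ∀ t ∈ Set.Icc a b, V t = V a * NormedSpace.exp ((t - a) • (G - R)) := by
  intro t₀ ht₀
  have hab : a ≤ b := ht₀.1.trans ht₀.2
  have hcE (x : 𝔸) : Continuous fun u : ℝ => NormedSpace.exp ((u - a) • x) :=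
    continuous_iff_continuousAt.2 fun t => (hasDerivAt_exp_sub_const_smul x a t).continuousAt
  have hcE' (x : 𝔸) : Continuous fun u : ℝ => NormedSpace.exp ((a - u) • x) :=
    continuous_iff_continuousAt.2 fun t => (hasDerivAt_exp_const_sub_smul x a t).continuousAt
  have hinv (x : 𝔸) (t : ℝ) :
      NormedSpace.exp ((a - t) • x) * NormedSpace.exp ((t - a) • x) = 1 := by
    rw [← exp_add_smul]; simp
  -- Since e^{(t-u)G} = e^{(a-u)G} e^{(t-a)G}, the dependence on t leaves the integral: V = W
  -- e^{(t-a)G} with W a primitive. Integrability of V then upgrades to continuity of W, V and f,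
  -- and so to differentiability of W.
  set f : ℝ → 𝔸 := fun u => V u * R * NormedSpace.exp ((a - u) • G) with hf
  set W : ℝ → 𝔸 := fun t => V a - ∫ u in a..t, f u with hW
  have hfint : IntervalIntegrable f volume a b :=
    (hint.mul_const R).mul_continuousOn (hcE' G).continuousOn
  have hVW : ∀ t ∈ Set.Icc a b, V t = W t * NormedSpace.exp ((t - a) • G) := by
    intro t ht
    have hsub : IntervalIntegrable f volume a t :=
      hfint.mono_set (Set.uIcc_subset_uIcc Set.left_mem_uIcc (by rwa [Set.uIcc_of_le hab]))
    have hcomm := ((ContinuousLinearMap.mul ℝ 𝔸).flip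
      (NormedSpace.exp ((t - a) • G))).intervalIntegral_comp_comm hsub
    simp only [ContinuousLinearMap.flip_apply, ContinuousLinearMap.mul_apply'] at hcomm
    rw [hV t ht, hW]
    simp only [sub_mul]
    rw [← hcomm]
    congr 1
    refine intervalIntegral.integral_congr fun u _ => ?_
    simp only [hf]
    rw [mul_assoc _ (NormedSpace.exp ((a - u) • G)), ← exp_add_smul]
    congr 3
    ring
  have hWcont : ContinuousOn W (Set.Icc a b) := by
    have := intervalIntegral.continuousOn_primitive_interval' hfint Set.left_mem_uIcc
    rw [Set.uIcc_of_le hab] at this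
    exact continuousOn_const.sub this
  have hVcont : ContinuousOn V (Set.Icc a b) :=
    (hWcont.mul (hcE G).continuousOn).congr hVW
  have hfcont : ContinuousOn f (Set.Icc a b) :=
    (hVcont.mul continuousOn_const).mul (hcE' G).continuousOn
  have hWderiv : ∀ x ∈ Set.Ico a b, HasDerivWithinAt W (-f x) (Set.Ici x) x := by
    intro x hx
    have hsub : IntervalIntegrable f volume a x :=
      hfint.mono_set (Set.uIcc_subset_uIcc Set.left_mem_uIcc
        (by rw [Set.uIcc_of_le hab]; exact ⟨hx.1, hx.2.le⟩))
    have hss : Set.Ioc x b ⊆ Set.Icc a b := fun y hy => ⟨hx.1.trans hy.1.le, hy.2⟩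
    have hmem : Set.Ioc x b ∈ 𝓝[>] x := Ioc_mem_nhdsGT hx.2
    have h1 : StronglyMeasurableAtFilter f (𝓝[>] x) :=
      ⟨_, hmem, (hfcont.mono hss).aestronglyMeasurable measurableSet_Ioc⟩
    have h2 : ContinuousWithinAt f (Set.Ioi x) x :=
      ((hfcont x ⟨hx.1, hx.2.le⟩).mono hss).mono_of_mem_nhdsWithin hmem
    exact (intervalIntegral.integral_hasDerivWithinAt_right hsub (s := Set.Ici x)
      (t := Set.Ioi x) h1 h2).const_sub _
  -- The function is V e^{(a-t)(G-R)}. Its right derivative is (-VR + VG - V(G-R)) e^{(a-t)(G-R)} =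
  -- 0.
  have hconst := constant_of_has_deriv_right_zero
    (f := fun t => W t * NormedSpace.exp ((t - a) • G) * NormedSpace.exp ((a - t) • (G - R)))
    (a := a) (b := b)
    ((hWcont.mul (hcE G).continuousOn).mul (hcE' _).continuousOn) (by
      intro x hx
      have h := ((hWderiv x hx).mul
        (hasDerivAt_exp_sub_const_smul G a x).hasDerivWithinAt).mul
        (hasDerivAt_exp_const_sub_smul (G - R) a x).hasDerivWithinAt
      refine h.congr_deriv ?_
      have e1 : f x * NormedSpace.exp ((x - a) • G) = V x * R := by
        simp only [hf]
        rw [mul_assoc, hinv, mul_one]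
      have e2 := hVW x ⟨hx.1, hx.2.le⟩
      have e3 : G * NormedSpace.exp ((x - a) • G) = NormedSpace.exp ((x - a) • G) * G := by
        have := (hasDerivAt_exp_smul_const' G (x - a)).unique
          (hasDerivAt_exp_smul_const G (x - a))
        exact this
      rw [Pi.mul_apply, neg_mul, e1, e3, ← mul_assoc, ← e2]
      noncomm_ring)
  have h := hconst t₀ ht₀
  simp only [sub_self, zero_smul, NormedSpace.exp_zero, mul_one] at h
  rw [← hVW t₀ ht₀] at h
  have hinv' : NormedSpace.exp ((a - t₀) • (G - R)) * NormedSpace.exp ((t₀ - a) • (G - R)) = 1 :=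
    hinv _ _
  have hWa : W a = V a := by simp [hW]
  rw [← hWa, ← h, mul_assoc, hinv', mul_one]

/-- The same, with integrals taken in the coordinates of a basis. -/
theorem eq_exp_of_variation_of_constants_coord {ι : Type*} [Fintype ι] (e : Module.Basis ι ℝ 𝔸)
    {V : ℝ → 𝔸} {G R : 𝔸} {a b : ℝ}
    (hint : ∀ i, IntervalIntegrable (fun u => e.repr (V u) i) volume a b)
    (hV : ∀ t ∈ Set.Icc a b, ∀ i, e.repr (V t) i =
      e.repr (V a * NormedSpace.exp ((t - a) • G)) i
        - ∫ u in a..t, e.repr (V u * R * NormedSpace.exp ((t - u) • G)) i) :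
    ∀ t ∈ Set.Icc a b, V t = V a * NormedSpace.exp ((t - a) • (G - R)) := by
  have : FiniteDimensional ℝ 𝔸 := e.finiteDimensional_of_finite
  have hint' : IntervalIntegrable V volume a b := by
    have : V = ∑ i, fun u => e.repr (V u) i • e i := by
      funext u
      simp [e.sum_repr]
    rw [this]
    exact IntervalIntegrable.sum _ fun i _ =>
      ⟨(hint i).1.smul_const _, (hint i).2.smul_const _⟩
  refine eq_exp_of_variation_of_constants hint' fun t ht => e.ext_elem fun i => ?_
  have hsub : IntervalIntegrable (fun u => V u * R * NormedSpace.exp ((t - u) • G))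
      volume a t := by
    refine IntervalIntegrable.mul_continuousOn (IntervalIntegrable.mul_const ?_ R) ?_
    · exact hint'.mono_set (Set.uIcc_subset_uIcc Set.left_mem_uIcc
        (by rwa [Set.uIcc_of_le (ht.1.trans ht.2)]))
    · exact (continuous_iff_continuousAt.2 fun u =>
        (hasDerivAt_exp_const_sub_smul G t u).continuousAt).continuousOn
  have hcomm := (LinearMap.toContinuousLinearMap (e.coord i)).intervalIntegral_comp_comm hsub
  simp only [LinearMap.coe_toContinuousLinearMap', Module.Basis.coord_apply] at hcomm
  rw [hV t ht i, hcomm, map_sub, Finsupp.sub_apply]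

end BanachAlgebra

/-! ### Matrix exponentials -/

section MatrixExponential

variable {n : ℕ}

attribute [local instance] Matrix.linftyOpNormedRing Matrix.linftyOpNormedAlgebra

/-- The integrals are entrywise, hence of real functions; the operator norm only serves to make
matrices a Banach algebra. -/
theorem matrix_eq_exp_of_variation_of_constants {V : ℝ → Matrix (Fin n) (Fin n) ℝ}
    {G R : Matrix (Fin n) (Fin n) ℝ} {a b : ℝ}
    (hint : ∀ i j, IntervalIntegrable (fun u => V u i j) volume a b)
    (hV : ∀ t ∈ Set.Icc a b, ∀ i j, V t i j = (V a * NormedSpace.exp ((t - a) • G)) i j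
      - ∫ u in a..t, (V u * R * NormedSpace.exp ((t - u) • G)) i j) :
    ∀ t ∈ Set.Icc a b, V t = V a * NormedSpace.exp ((t - a) • (G - R)) :=
  eq_exp_of_variation_of_constants_coord (Matrix.stdBasis ℝ (Fin n) (Fin n))
    (fun i => hint i.1 i.2) fun t ht i => hV t ht i.1 i.2

theorem hasDerivAt_exp_smul_mulVec (A : Matrix (Fin n) (Fin n) ℝ) (f : Fin n → ℝ) (i : Fin n)
    (t : ℝ) :
    HasDerivAt (fun u : ℝ => (NormedSpace.exp (u • A) *ᵥ f) i)
      ((NormedSpace.exp (t • A) *ᵥ (A *ᵥ f)) i) t := by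
  have h := hasDerivAt_exp_smul_const A t
  have hL := (LinearMap.toContinuousLinearMap
    ((LinearMap.proj i : (Fin n → ℝ) →ₗ[ℝ] ℝ) ∘ₗ
      (Matrix.mulVecBilin ℝ ℝ).flip f)).hasFDerivAt.comp_hasDerivAt t h
  rw [Matrix.mulVec_mulVec]
  exact hL

/-- The entries of e^{-cu} e^{uA} f have zero derivative in u. -/
theorem exp_smul_mulVec_of_eigenvector {A : Matrix (Fin n) (Fin n) ℝ} {f : Fin n → ℝ} {c : ℝ}
    (hA : A *ᵥ f = c • f) (t : ℝ) :
    NormedSpace.exp (t • A) *ᵥ f = Real.exp (c * t) • f := by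
  funext i
  have hd : ∀ u : ℝ, HasDerivAt
      (fun u : ℝ => Real.exp (-(c * u)) * (NormedSpace.exp (u • A) *ᵥ f) i) 0 u := by
    intro u
    have h1 : HasDerivAt (fun u : ℝ => Real.exp (-(c * u))) (Real.exp (-(c * u)) * -c) u := by
      have := (((hasDerivAt_id u).const_mul c).neg).exp
      simpa using this
    refine (h1.mul (hasDerivAt_exp_smul_mulVec A f i u)).congr_deriv ?_
    rw [hA, Matrix.mulVec_smul]
    simp only [Pi.smul_apply, smul_eq_mul]
    ring
  have h := is_const_of_deriv_eq_zero (fun u => (hd u).differentiableAt)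
    (fun u => (hd u).deriv) t 0
  simp only [mul_zero, neg_zero, Real.exp_zero, zero_smul, NormedSpace.exp_zero,
    Matrix.one_mulVec, one_mul] at h
  rw [Pi.smul_apply, ← h, smul_eq_mul, ← mul_assoc, ← Real.exp_add]
  simp

end MatrixExponential

/-! ### Perron–Frobenius uniqueness and the transformed generator -/

section GeneratorMatrix

variable {n : ℕ} {G : Matrix (Fin n) (Fin n) ℝ}

/-- Backward propagation of zeros suits state probabilities, whose evolution sums over incoming
rates; the forward version below suits eigenvectors, whose equation sums over outgoing rates. -/
theorem IsIrreducibleGenerator.eq_zero_of_backward_closed (hirr : IsIrreducibleGenerator G)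
    {w : Fin n → ℝ} {i : Fin n} (hi : w i = 0)
    (hstep : ∀ a b, 0 < G a b → w b = 0 → w a = 0) (j : Fin n) : w j = 0 :=
  Relation.ReflTransGen.head_induction_on (hirr j i) hi fun hab _ hb => hstep _ _ hab hb

theorem IsIrreducibleGenerator.eq_zero_of_forward_closed (hirr : IsIrreducibleGenerator G)
    {w : Fin n → ℝ} {i : Fin n} (hi : w i = 0)
    (hstep : ∀ a b, 0 < G a b → w a = 0 → w b = 0) (j : Fin n) : w j = 0 := by
  induction hirr i j with
  | refl => exact hi
  | tail _ hab ih => exact hstep _ _ hab ih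

theorem IsGeneratorMatrix.ne_of_pos (hG : IsGeneratorMatrix G) {a b : Fin n} (h : 0 < G a b) :
    a ≠ b := by
  rintro rfl
  have h1 := hG.row_sum a
  rw [← Finset.add_sum_erase _ _ (Finset.mem_univ a)] at h1
  have h2 : 0 ≤ ∑ j ∈ Finset.univ.erase a, G a j := Finset.sum_nonneg fun j hj =>
    hG.nonneg_off_diag a j (Finset.ne_of_mem_erase hj).symm
  linarith

theorem sub_diagonal_mulVec_apply (G : Matrix (Fin n) (Fin n) ℝ) (r f : Fin n → ℝ) (i : Fin n) :
    ((G - Matrix.diagonal r) *ᵥ f) i = ∑ j, G i j * f j - r i * f i := by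
  rw [Matrix.sub_mulVec, Pi.sub_apply, Matrix.mulVec_diagonal]
  rfl

theorem sub_diagonal_mulVec_of_zero (G : Matrix (Fin n) (Fin n) ℝ) (r : Fin n → ℝ)
    {w : Fin n → ℝ} {i : Fin n} (hi : w i = 0) :
    ((G - Matrix.diagonal r) *ᵥ w) i = ∑ j ∈ Finset.univ.erase i, G i j * w j := by
  rw [sub_diagonal_mulVec_apply, ← Finset.add_sum_erase _ _ (Finset.mem_univ i), hi]
  ring

/-- Take c = min f/p, the largest multiple of p lying below f, and i a point of contact. In row i of
(G-R)(f - c p) = a f - b c p the diagonal and `r` terms vanish, and c p i = f i. -/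
theorem exists_touching_eigenvector {r f p : Fin n → ℝ}
    {a b : ℝ} (hp : ∀ i, 0 < p i)
    (hpe : (G - Matrix.diagonal r) *ᵥ p = b • p) (hfe : (G - Matrix.diagonal r) *ᵥ f = a • f)
    (i₀ : Fin n) : ∃ (c : ℝ) (i : Fin n), (∀ j, 0 ≤ f j - c * p j) ∧ f i - c * p i = 0 ∧
      ∑ j ∈ Finset.univ.erase i, G i j * (f j - c * p j) = (a - b) * f i := by
  obtain ⟨i, -, hi⟩ := Finset.exists_min_image Finset.univ (fun i => f i / p i)
    ⟨i₀, Finset.mem_univ _⟩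
  have hzero : f i - f i / p i * p i = 0 := by
    rw [div_mul_cancel₀ _ (hp i).ne', sub_self]
  refine ⟨f i / p i, i, fun j => ?_, hzero, ?_⟩
  · have := hi j (Finset.mem_univ j)
    rw [le_div_iff₀ (hp j)] at this
    linarith
  · rw [← sub_diagonal_mulVec_of_zero G r (w := fun j => f j - f i / p i * p j) hzero]
    have : (fun j => f j - f i / p i * p j) = f - (f i / p i) • p := by
      funext j; simp
    rw [this, Matrix.mulVec_sub, Matrix.mulVec_smul, hpe, hfe]
    simp only [Pi.sub_apply, Pi.smul_apply, smul_eq_mul]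
    linear_combination (b : ℝ) * hzero

/-- At the point of contact the off-diagonal sum is nonnegative, so (a - b) f i ≥ 0. -/
theorem IsGeneratorMatrix.eigenvalue_le (hG : IsGeneratorMatrix G) {r f p : Fin n → ℝ}
    {a b : ℝ} (hf : ∀ i, 0 < f i) (hp : ∀ i, 0 < p i)
    (hpe : (G - Matrix.diagonal r) *ᵥ p = b • p) (hfe : (G - Matrix.diagonal r) *ᵥ f = a • f)
    (i₀ : Fin n) : b ≤ a := by
  obtain ⟨c, i, hnn, -, hsum⟩ := exists_touching_eigenvector hp hpe hfe i₀
  have h : 0 ≤ (a - b) * f i := hsum ▸ Finset.sum_nonneg fun j hj =>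
    mul_nonneg (hG.nonneg_off_diag i j (Finset.ne_of_mem_erase hj).symm) (hnn j)
  linarith [nonneg_of_mul_nonneg_left h (hf i)]

/-- Perron–Frobenius uniqueness: a positive eigenvector of `G - R` is unique up to scaling, and so
is its eigenvalue. -/
theorem IsGeneratorMatrix.positive_eigenvector_unique (hG : IsGeneratorMatrix G)
    (hirr : IsIrreducibleGenerator G) {r f p : Fin n → ℝ}
    {a b : ℝ} (hf : ∀ i, 0 < f i) (hp : ∀ i, 0 < p i)
    (hpe : (G - Matrix.diagonal r) *ᵥ p = b • p) (hfe : (G - Matrix.diagonal r) *ᵥ f = a • f)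
    (i₀ : Fin n) : a = b ∧ ∃ c, ∀ i, f i = c * p i := by
  have hab : a = b := le_antisymm (hG.eigenvalue_le hp hf hfe hpe i₀)
    (hG.eigenvalue_le hf hp hpe hfe i₀)
  refine ⟨hab, ?_⟩
  subst hab
  obtain ⟨c, i, hnn, hi, -⟩ := exists_touching_eigenvector hp hpe hfe i₀
  refine ⟨c, fun j => ?_⟩
  have hw : (G - Matrix.diagonal r) *ᵥ (fun j => f j - c * p j) =
      a • (fun j => f j - c * p j) := by
    have : (fun j => f j - c * p j) = f - c • p := by
      funext j; simp
    rw [this, Matrix.mulVec_sub, Matrix.mulVec_smul, hpe, hfe, smul_sub, smul_comm]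
  -- The difference f - c p is a nonnegative eigenvector with a zero. Its equation at a zero is a
  -- vanishing sum of nonnegative terms, so every successor state is a zero too.
  refine sub_eq_zero.1 (hirr.eq_zero_of_forward_closed
    (w := fun j => f j - c * p j) hi (fun k l hkl hk => ?_) j)
  have h0 : ∑ j ∈ Finset.univ.erase k, G k j * (f j - c * p j) = 0 := by
    rw [← sub_diagonal_mulVec_of_zero G r (w := fun j => f j - c * p j) hk, hw]
    simp only [Pi.smul_apply, smul_eq_mul]
    rw [hk, mul_zero]
  have hkl' := (Finset.sum_eq_zero_iff_of_nonneg fun j hj =>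
    mul_nonneg (hG.nonneg_off_diag k j (Finset.ne_of_mem_erase hj).symm) (hnn j)).1 h0 l
      (Finset.mem_erase.2 ⟨(hG.ne_of_pos hkl).symm, Finset.mem_univ _⟩)
  exact (mul_eq_zero.1 hkl').resolve_left hkl.ne'

theorem IsGeneratorMatrix.recoveredGenerator (hG : IsGeneratorMatrix G) {p : Fin n → ℝ}
    (hp : ∀ i, 0 < p i) : IsGeneratorMatrix (recoveredGenerator G p) where
  nonneg_off_diag i j hij := by
    simp only [_root_.recoveredGenerator, Matrix.of_apply, if_neg hij]
    exact mul_nonneg (div_pos (hp j) (hp i)).le (hG.nonneg_off_diag i j hij)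
  row_sum i := by
    rw [← Finset.add_sum_erase _ _ (Finset.mem_univ i)]
    simp only [_root_.recoveredGenerator, Matrix.of_apply, if_true]
    rw [neg_add_eq_zero]
    refine Finset.sum_congr rfl fun j hj => ?_
    rw [if_neg (Finset.ne_of_mem_erase hj).symm]

theorem IsIrreducibleGenerator.recoveredGenerator (hG : IsGeneratorMatrix G)
    (hirr : IsIrreducibleGenerator G) {p : Fin n → ℝ} (hp : ∀ i, 0 < p i) :
    IsIrreducibleGenerator (recoveredGenerator G p) := fun i j =>
  Relation.ReflTransGen.mono (fun a b hab => by
    simp only [_root_.recoveredGenerator, Matrix.of_apply, if_neg (hG.ne_of_pos hab)]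
    exact mul_pos (div_pos (hp b) (hp a)) hab) i j (hirr i j)

/-- This is Doob's h-transform. Only the diagonal needs the eigenvector equation, which gives the
sum of G i k * p k over k ≠ i as (c + r i - G i i) p i. -/
theorem recoveredGenerator_eq_conj {r p : Fin n → ℝ} {c : ℝ} (hp : ∀ i, 0 < p i)
    (hpe : (G - Matrix.diagonal r) *ᵥ p = c • p) :
    recoveredGenerator G p =
      Matrix.diagonal (fun i => (p i)⁻¹) * (G - Matrix.diagonal r) * Matrix.diagonal p
        - c • (1 : Matrix (Fin n) (Fin n) ℝ) := by
  ext i j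
  have hpi := (hp i).ne'
  rw [Matrix.sub_apply, Matrix.mul_diagonal, Matrix.diagonal_mul, Matrix.sub_apply,
    Matrix.smul_apply, recoveredGenerator, Matrix.of_apply]
  split_ifs with hij
  · subst hij
    have h := congrFun hpe i
    rw [sub_diagonal_mulVec_apply, ← Finset.add_sum_erase _ _ (Finset.mem_univ i)] at h
    simp only [Pi.smul_apply, smul_eq_mul] at h
    have hs : ∑ k ∈ Finset.univ.erase i, p k / p i * G i k =
        (p i)⁻¹ * ∑ k ∈ Finset.univ.erase i, G i k * p k := by
      rw [Finset.mul_sum]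
      exact Finset.sum_congr rfl fun k _ => by ring
    rw [hs]
    have hS : ∑ k ∈ Finset.univ.erase i, G i k * p k = (c + r i - G i i) * p i := by linarith
    rw [hS]
    simp only [Matrix.diagonal_apply_eq, Matrix.one_apply_eq, smul_eq_mul]
    field_simp
    ring
  · rw [Matrix.diagonal_apply_ne _ hij, Matrix.one_apply_ne hij]
    simp only [smul_eq_mul]
    ring

/-- The exponential commutes with conjugation and turns the scalar shift by -c into the factor
e^{-ct}. -/
theorem exp_smul_recoveredGenerator {r p : Fin n → ℝ} {c : ℝ} (hp : ∀ i, 0 < p i)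
    (hpe : (G - Matrix.diagonal r) *ᵥ p = c • p) (t : ℝ) (i j : Fin n) :
    NormedSpace.exp (t • recoveredGenerator G p) i j =
      Real.exp (-(c * t)) * (p j / p i) * NormedSpace.exp (t • (G - Matrix.diagonal r)) i j := by
  have hinv : (Matrix.diagonal p) * Matrix.diagonal (fun i => (p i)⁻¹) = 1 := by
    rw [Matrix.diagonal_mul_diagonal, ← Matrix.diagonal_one]
    congr 1; funext i; exact mul_inv_cancel₀ (hp i).ne'
  have hinv' : Matrix.diagonal (fun i => (p i)⁻¹) * (Matrix.diagonal p) = 1 := by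
    rw [Matrix.diagonal_mul_diagonal, ← Matrix.diagonal_one]
    congr 1; funext i; exact inv_mul_cancel₀ (hp i).ne'
  let U : (Matrix (Fin n) (Fin n) ℝ)ˣ :=
    ⟨Matrix.diagonal (fun i => (p i)⁻¹), Matrix.diagonal p, hinv', hinv⟩
  have h1 : t • recoveredGenerator G p =
      (U : Matrix (Fin n) (Fin n) ℝ) * (t • (G - Matrix.diagonal r)) *
        ((U⁻¹ : (Matrix (Fin n) (Fin n) ℝ)ˣ) : Matrix (Fin n) (Fin n) ℝ)
        + Matrix.diagonal (fun _ => -(c * t)) := by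
    rw [recoveredGenerator_eq_conj hp hpe, smul_sub, sub_eq_add_neg, Matrix.mul_smul,
      Matrix.smul_mul]
    congr 1
    rw [← Matrix.smul_one_eq_diagonal, smul_smul, neg_smul, mul_comm]
  rw [h1, Matrix.exp_add_of_commute, Matrix.exp_units_conj, Matrix.exp_diagonal,
    Matrix.mul_diagonal]
  · change (Matrix.diagonal (fun i => (p i)⁻¹) *
      NormedSpace.exp (t • (G - Matrix.diagonal r)) * Matrix.diagonal p) i j * _ = _
    rw [Matrix.mul_diagonal, Matrix.diagonal_mul, Pi.coe_exp, Real.exp_eq_exp_ℝ]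
    ring
  · rw [← Matrix.smul_one_eq_diagonal]
    exact (Commute.one_right _).smul_right _

end GeneratorMatrix

/-! ### Path regularity and the discount factor -/

section Paths

variable {Ω : Type*} {n : ℕ}

/-- The path of `J` stopped at time `T`, indexed by all real times. -/
def stoppedPath (J : ℝ≥0 → Ω → Fin n) (T : ℝ≥0) (s : ℝ) (ω : Ω) : Fin n :=
  J (min s.toNNReal T) ω

theorem stoppedPath_coe (J : ℝ≥0 → Ω → Fin n) {t T : ℝ≥0} (h : t ≤ T) (ω : Ω) :
    stoppedPath J T t ω = J t ω := by
  rw [stoppedPath, Real.toNNReal_coe, min_eq_left h]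

/-- The discount factor computed along the stopped path. -/
noncomputable def stoppedDiscount (r : Fin n → ℝ) (J : ℝ≥0 → Ω → Fin n) (T : ℝ≥0) (u : ℝ)
    (ω : Ω) : ℝ :=
  Real.exp (-∫ s in (0 : ℝ)..u, r (stoppedPath J T s ω))

theorem discount_eq_stoppedDiscount (r : Fin n → ℝ) (J : ℝ≥0 → Ω → Fin n) {t T : ℝ≥0}
    (h : t ≤ T) (ω : Ω) : discount r J t ω = stoppedDiscount r J T t ω := by
  rw [discount, stoppedDiscount]
  congr 2
  refine intervalIntegral.integral_congr fun s hs => ?_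
  rw [Set.uIcc_of_le t.coe_nonneg] at hs
  have : s.toNNReal ≤ T := (Real.toNNReal_le_iff_le_coe.2 hs.2).trans h
  simp only [stoppedPath, min_eq_left this]

/-- Negative times are sent to 0 and times beyond T to T, so right-continuity on [0, T) extends to
the whole line. -/
theorem stoppedPath_right_continuous {J : ℝ≥0 → Ω → Fin n} {T : ℝ≥0} {ω : Ω}
    (hr : ∀ t < T, ∀ᶠ s in 𝓝[>] t, J s ω = J t ω) (x : ℝ) :
    ∀ᶠ y in 𝓝[≥] x, stoppedPath J T y ω = stoppedPath J T x ω := by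
  have htend : Filter.Tendsto (fun y : ℝ => min y.toNNReal T) (𝓝[≥] x)
      (𝓝[≥] (min x.toNNReal T)) := by
    refine tendsto_nhdsWithin_iff.2 ⟨?_, ?_⟩
    · exact ((continuous_real_toNNReal.min continuous_const).tendsto x).mono_left
        nhdsWithin_le_nhds
    · filter_upwards [self_mem_nhdsWithin] with y hy
      exact min_le_min_right T (Real.toNNReal_mono hy)
  rcases lt_or_ge x.toNNReal T with hx | hx
  · rw [min_eq_left hx.le] at htend
    have h2 : ∀ᶠ s in 𝓝[≥] x.toNNReal, J s ω = J x.toNNReal ω := by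
      rw [← Set.Ioi_insert, nhdsWithin_insert]
      exact Filter.eventually_sup.2 ⟨by simp, hr _ hx⟩
    filter_upwards [htend.eventually h2] with y hy
    rw [stoppedPath, hy, stoppedPath, min_eq_left hx.le]
  · filter_upwards [self_mem_nhdsWithin] with y hy
    have hy' : T ≤ y.toNNReal := hx.trans (Real.toNNReal_mono hy)
    rw [stoppedPath, stoppedPath, min_eq_right hx, min_eq_right hy']

theorem measurable_stoppedPath [MeasurableSpace Ω] {J : ℝ≥0 → Ω → Fin n} {T : ℝ≥0}
    (hm : ∀ s ≤ T, Measurable (J s))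
    (hr : ∀ ω, ∀ t < T, ∀ᶠ s in 𝓝[>] t, J s ω = J t ω) :
    Measurable (Function.uncurry (stoppedPath J T)) := by
  -- The next point to the right of x on the grid of mesh 1/(k+1). Grid times are countable, which
  -- gives joint measurability of the discretised path; right-continuity passes to the limit.
  let g (k : ℕ) (x : ℝ) : ℝ := ((⌊x * (k + 1)⌋ : ℝ) + 1) / (k + 1)
  have hg (x : ℝ) : Filter.Tendsto (fun k => g k x) Filter.atTop (𝓝[≥] x) := by
    have hle (k : ℕ) : x ≤ g k x := by
      rw [le_div_iff₀ (by positivity)]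
      exact (Int.lt_floor_add_one _).le
    refine tendsto_nhdsWithin_iff.2 ⟨?_, Filter.Eventually.of_forall hle⟩
    refine tendsto_of_tendsto_of_tendsto_of_le_of_le tendsto_const_nhds
      (h := fun k : ℕ => x + 1 / ((k : ℝ) + 1)) ?_ hle fun k => ?_
    · simpa using (tendsto_one_div_add_atTop_nhds_zero_nat (𝕜 := ℝ)).const_add x
    · have hk : (0 : ℝ) < k + 1 := by positivity
      rw [div_le_iff₀ hk, add_mul, one_div_mul_cancel hk.ne']
      linarith [Int.floor_le (x * ((k : ℝ) + 1))]
  refine measurable_of_tendsto_metrizable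
    (f := fun k (p : ℝ × Ω) => stoppedPath J T (g k p.1) p.2) (fun k => ?_) ?_
  · have h1 : Measurable fun q : ℤ × Ω =>
        stoppedPath J T (((q.1 : ℝ) + 1) / (k + 1)) q.2 :=
      measurable_from_prod_countable_right fun z =>
        hm (min (((z : ℝ) + 1) / (k + 1)).toNNReal T) (min_le_right _ _)
    have h2 : Measurable fun p : ℝ × Ω => (⌊p.1 * ((k : ℝ) + 1)⌋, p.2) :=
      (Int.measurable_floor.comp (measurable_fst.mul_const _)).prodMk measurable_snd
    have h3 : (fun p : ℝ × Ω => stoppedPath J T (g k p.1) p.2) =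
        (fun q : ℤ × Ω => stoppedPath J T (((q.1 : ℝ) + 1) / (k + 1)) q.2) ∘
          fun p : ℝ × Ω => (⌊p.1 * ((k : ℝ) + 1)⌋, p.2) := rfl
    rw [h3]
    exact h1.comp h2
  · refine tendsto_pi_nhds.2 fun p => ?_
    refine tendsto_const_nhds.congr' ?_
    filter_upwards [(hg p.1).eventually (stoppedPath_right_continuous (hr p.2) p.1)] with k hk
    exact hk.symm

theorem exists_abs_le (r : Fin n → ℝ) : ∃ C, 0 ≤ C ∧ ∀ i, |r i| ≤ C :=
  ⟨∑ i, |r i|, Finset.sum_nonneg fun _ _ => abs_nonneg _, fun i =>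
    Finset.single_le_sum (f := fun i => |r i|) (fun _ _ => abs_nonneg _) (Finset.mem_univ i)⟩

section

variable [MeasurableSpace Ω] {J : ℝ≥0 → Ω → Fin n} {T : ℝ≥0}

theorem intervalIntegrable_stoppedPath
    (hm : ∀ s ≤ T, Measurable (J s)) (hr : ∀ ω, ∀ t < T, ∀ᶠ s in 𝓝[>] t, J s ω = J t ω)
    (r : Fin n → ℝ) (ω : Ω) (a b : ℝ) :
    IntervalIntegrable (fun s => r (stoppedPath J T s ω)) volume a b := by
  obtain ⟨C, -, hC⟩ := exists_abs_le r
  have hmeas : Measurable fun s => r (stoppedPath J T s ω) :=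
    (measurable_of_finite r).comp ((measurable_stoppedPath hm hr).comp measurable_prodMk_right)
  refine (intervalIntegrable_const (c := C)).mono_fun hmeas.aestronglyMeasurable ?_
  exact Filter.Eventually.of_forall fun s => (hC _).trans (le_abs_self _)

theorem continuous_stoppedDiscount
    (hm : ∀ s ≤ T, Measurable (J s)) (hr : ∀ ω, ∀ t < T, ∀ᶠ s in 𝓝[>] t, J s ω = J t ω)
    (r : Fin n → ℝ) (ω : Ω) :
    Continuous fun u => stoppedDiscount r J T u ω :=
  Real.continuous_exp.comp (intervalIntegral.continuous_primitive
    (intervalIntegrable_stoppedPath hm hr r ω) 0).neg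

theorem measurable_stoppedDiscount
    (hm : ∀ s ≤ T, Measurable (J s)) (hr : ∀ ω, ∀ t < T, ∀ᶠ s in 𝓝[>] t, J s ω = J t ω)
    (r : Fin n → ℝ) :
    Measurable (Function.uncurry (stoppedDiscount r J T)) := by
  refine measurable_uncurry_of_continuous_of_measurable
    (continuous_stoppedDiscount hm hr r) fun u => ?_
  have hs : StronglyMeasurable (Function.uncurry fun s ω => r (stoppedPath J T s ω)) :=
    ((measurable_of_finite r).comp (measurable_stoppedPath hm hr)).stronglyMeasurable
  refine Real.measurable_exp.comp (Measurable.neg ?_)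
  simp only [intervalIntegral.intervalIntegral_eq_integral_uIoc]
  exact (StronglyMeasurable.integral_prod_left
    (μ := volume.restrict (Set.uIoc 0 u)) hs).measurable.const_smul
    (if 0 ≤ u then (1 : ℝ) else -1)

/-- The rate jumps, so D has only a right derivative -rD in general; with D continuous this suffices
for the fundamental theorem of calculus. -/
theorem stoppedDiscount_eq_sub_integral
    (hm : ∀ s ≤ T, Measurable (J s)) (hr : ∀ ω, ∀ t < T, ∀ᶠ s in 𝓝[>] t, J s ω = J t ω)
    (r : Fin n → ℝ) (ω : Ω) (a b : ℝ) :
    stoppedDiscount r J T b ω = stoppedDiscount r J T a ω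
      - ∫ u in a..b, r (stoppedPath J T u ω) * stoppedDiscount r J T u ω := by
  have hint := intervalIntegrable_stoppedPath hm hr r ω
  have hcont := continuous_stoppedDiscount hm hr r ω
  have h := intervalIntegral.integral_eq_sub_of_hasDeriv_right (a := a) (b := b)
    (f := fun u => stoppedDiscount r J T u ω)
    (f' := fun u => -(r (stoppedPath J T u ω) * stoppedDiscount r J T u ω))
    hcont.continuousOn (fun x _ => ?_) ((hint a b).mul_continuousOn hcont.continuousOn).neg
  · rw [intervalIntegral.integral_neg] at h
    linarith
  · have hev := stoppedPath_right_continuous (hr ω) x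
    have hcw : ContinuousWithinAt (fun s => r (stoppedPath J T s ω)) (Set.Ici x) x := by
      refine tendsto_const_nhds.congr' ?_
      filter_upwards [hev] with y hy
      rw [hy]
    have hmeas : Measurable fun s => r (stoppedPath J T s ω) :=
      (measurable_of_finite r).comp ((measurable_stoppedPath hm hr).comp measurable_prodMk_right)
    have h1 := intervalIntegral.integral_hasDerivWithinAt_right (hint 0 x) (s := Set.Ici x)
      (t := Set.Ioi x) hmeas.stronglyMeasurable.stronglyMeasurableAtFilter
      (hcw.mono Set.Ioi_subset_Ici_self)
    have h2 := (h1.neg.exp).mono Set.Ioi_subset_Ici_self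
    refine h2.congr_deriv ?_
    rw [stoppedDiscount]
    simp only [Pi.neg_apply]
    ring

end

theorem stoppedDiscount_pos (r : Fin n → ℝ) (J : ℝ≥0 → Ω → Fin n) (T : ℝ≥0) (u : ℝ) (ω : Ω) :
    0 < stoppedDiscount r J T u ω := Real.exp_pos _

theorem stoppedDiscount_le_one {r : Fin n → ℝ} (h : ∀ i, 0 ≤ r i) (J : ℝ≥0 → Ω → Fin n)
    (T : ℝ≥0) {u : ℝ} (hu : 0 ≤ u) (ω : Ω) : stoppedDiscount r J T u ω ≤ 1 := by
  rw [stoppedDiscount, Real.exp_le_one_iff, neg_nonpos]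
  exact intervalIntegral.integral_nonneg hu fun _ _ => h _

end Paths

/-! ### Adaptedness and the Markov property -/

section Chain

variable {Ω : Type*} {m : MeasurableSpace Ω} {F : Filtration ℝ≥0 m} {μ : Measure Ω}
  {Tb : ℝ≥0} {n : ℕ} {G : Matrix (Fin n) (Fin n) ℝ} {J : ℝ≥0 → Ω → Fin n}

theorem IsCTMC.measurable (hJ : IsCTMC F μ Tb G J) {t : ℝ≥0} (ht : t ≤ Tb) :
    Measurable (J t) := (hJ.adapted t ht).mono (F.le t) le_rfl

theorem IsCTMC.measurable_of_le (hJ : IsCTMC F μ Tb G J) {s t : ℝ≥0} (hst : s ≤ t)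
    (ht : t ≤ Tb) : Measurable[F t] (J s) :=
  (hJ.adapted s (hst.trans ht)).mono (F.mono hst) le_rfl

theorem IsCTMC.measurable_discount (hJ : IsCTMC F μ Tb G J) (r : Fin n → ℝ) {t : ℝ≥0}
    (ht : t ≤ Tb) : Measurable[F t] (discount r J t) := by
  have h : discount r J t = fun ω => stoppedDiscount r J t t ω :=
    funext fun ω => discount_eq_stoppedDiscount r J le_rfl ω
  rw [h]
  -- The path stopped at t uses only J_s with s ≤ t, so joint measurability holds with F t as the
  -- σ-algebra on Ω.
  have := @measurable_stoppedDiscount Ω n (F t) J t (fun s hs => hJ.measurable_of_le hs ht)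
    (fun ω s hs => hJ.right_cont ω s (hs.trans_le ht)) r
  exact @Measurable.comp Ω (ℝ × Ω) ℝ (F t) (@Prod.instMeasurableSpace ℝ Ω _ (F t)) _ _ _ this
    (@measurable_prodMk_left ℝ Ω _ (F t) (t : ℝ))

/-- The Markov property, tested against a bounded `F u`-measurable weight. -/
theorem IsCTMC.integral_mul_indicator [IsFiniteMeasure μ] (hJ : IsCTMC F μ Tb G J) {u t : ℝ≥0}
    (hut : u ≤ t) (ht : t ≤ Tb) {Y : Ω → ℝ} (hY : Measurable[F u] Y) {C : ℝ}
    (hC : ∀ ω, |Y ω| ≤ C) (j : Fin n) :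
    ∫ ω, Y ω * (if J t ω = j then 1 else 0) ∂μ =
      ∑ k, (∫ ω, Y ω * (if J u ω = k then 1 else 0) ∂μ) *
        NormedSpace.exp (((t : ℝ) - u) • G) k j := by
  have hind : (J t ⁻¹' {j}).indicator (fun _ => (1 : ℝ)) =
      fun ω => if J t ω = j then (1 : ℝ) else 0 := by
    funext ω
    by_cases h : J t ω = j <;> simp [h]
  have hmeasJ (s : ℝ≥0) (hs : s ≤ Tb) (k : Fin n) :
      Measurable fun ω => if J s ω = k then (1 : ℝ) else 0 :=
    (measurable_of_finite fun i : Fin n => if i = k then (1 : ℝ) else 0).comp (hJ.measurable hs)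
  have hbd (s : ℝ≥0) (k : Fin n) (ω : Ω) : ‖if J s ω = k then (1 : ℝ) else 0‖ ≤ 1 := by
    split_ifs <;> simp
  have hi (s : ℝ≥0) (hs : s ≤ Tb) (k : Fin n) :
      Integrable (fun ω => if J s ω = k then (1 : ℝ) else 0) μ :=
    Integrable.of_bound (hmeasJ s hs k).aestronglyMeasurable 1
      (Filter.Eventually.of_forall (hbd s k))
  have hYm : Measurable Y := hY.mono (F.le u) le_rfl
  have hpull := condExp_stronglyMeasurable_mul_of_bound (F.le u) hY.stronglyMeasurable
    (hi t ht j) C (Filter.Eventually.of_forall hC)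
  have htr := hJ.transition u t hut ht j
  rw [hind] at htr
  calc ∫ ω, Y ω * (if J t ω = j then 1 else 0) ∂μ
      = ∫ ω, (μ[Y * (fun ω => if J t ω = j then (1 : ℝ) else 0) | F u]) ω ∂μ :=
        (integral_condExp (F.le u)).symm
    _ = ∫ ω, Y ω * NormedSpace.exp (((t : ℝ) - u) • G) (J u ω) j ∂μ := by
        refine integral_congr_ae ?_
        filter_upwards [hpull, htr] with ω h1 h2
        rw [h1, Pi.mul_apply, h2]
    _ = ∫ ω, ∑ k, (Y ω * (if J u ω = k then 1 else 0)) *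
          NormedSpace.exp (((t : ℝ) - u) • G) k j ∂μ := by
        refine integral_congr_ae (Filter.Eventually.of_forall fun ω => ?_)
        simp
    _ = _ := by
        rw [integral_finsetSum]
        · simp_rw [integral_mul_const]
        · intro k _
          exact ((hi u (hut.trans ht) k).bdd_mul hYm.aestronglyMeasurable
            (Filter.Eventually.of_forall hC)).mul_const _

end Chain

/-! ### The Feynman–Kac formula -/

section FeynmanKac

variable {Ω : Type*} {m : MeasurableSpace Ω} {F : Filtration ℝ≥0 m} {Q : Measure Ω}
  {Tb : ℝ≥0} {n : ℕ} {G : Matrix (Fin n) (Fin n) ℝ} {J : ℝ≥0 → Ω → Fin n}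
  {r : Fin n → ℝ}

/-- The discounted weight `E[Y D_t 1_{J_t = j}]` of state `j` at time `t`. -/
noncomputable def discountedWeight (Q : Measure Ω) (Tb : ℝ≥0) (r : Fin n → ℝ)
    (J : ℝ≥0 → Ω → Fin n) (Y : Ω → ℝ) (t : ℝ) (j : Fin n) : ℝ :=
  ∫ ω, Y ω * stoppedDiscount r J Tb t ω * (if stoppedPath J Tb t ω = j then 1 else 0) ∂Q

theorem IsCTMC.measurable_discountedWeight [IsFiniteMeasure Q] (hJ : IsCTMC F Q Tb G J) (r : Fin n → ℝ)
    {Y : Ω → ℝ} (hY : Measurable Y) (j : Fin n) :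
    Measurable fun t => discountedWeight Q Tb r J Y t j := by
  have hK := measurable_stoppedPath (fun s hs => hJ.measurable hs) hJ.right_cont
  have hD := measurable_stoppedDiscount (fun s hs => hJ.measurable hs) hJ.right_cont r
  have h : Measurable (Function.uncurry fun (t : ℝ) (ω : Ω) => Y ω *
      stoppedDiscount r J Tb t ω * (if stoppedPath J Tb t ω = j then (1 : ℝ) else 0)) :=
    ((hY.comp measurable_snd).mul hD).mul
      ((measurable_of_finite fun i : Fin n => if i = j then (1 : ℝ) else 0).comp hK)
  exact (StronglyMeasurable.integral_prod_right (ν := Q) h.stronglyMeasurable).measurable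

theorem abs_ite_le_one (i j : Fin n) : |if i = j then (1 : ℝ) else 0| ≤ 1 := by
  split_ifs <;> simp

theorem abs_mul_stoppedDiscount_mul_le (hr : ∀ i, 0 ≤ r i) {Y : Ω → ℝ} {C B : ℝ}
    (hC : ∀ ω, |Y ω| ≤ C) {t : ℝ} (ht : 0 ≤ t) {ω : Ω} {x : ℝ} (hx : |x| ≤ B) :
    |Y ω * stoppedDiscount r J Tb t ω * x| ≤ C * B := by
  have hC0 : 0 ≤ C := (abs_nonneg _).trans (hC ω)
  rw [abs_mul, abs_mul, abs_of_pos (stoppedDiscount_pos r J Tb t ω)]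
  refine mul_le_mul ?_ hx (abs_nonneg _) hC0
  calc |Y ω| * stoppedDiscount r J Tb t ω ≤ C * 1 :=
        mul_le_mul (hC ω) (stoppedDiscount_le_one hr J Tb ht ω)
          (stoppedDiscount_pos r J Tb t ω).le hC0
    _ = C := mul_one C

theorem IsCTMC.intervalIntegrable_discountedWeight [IsFiniteMeasure Q] (hJ : IsCTMC F Q Tb G J)
    (hr : ∀ i, 0 ≤ r i) {Y : Ω → ℝ} (hY : Measurable Y) {C : ℝ} (hC : ∀ ω, |Y ω| ≤ C)
    (j : Fin n) {a b : ℝ} (ha : 0 ≤ a) (hab : a ≤ b) :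
    IntervalIntegrable (fun t => discountedWeight Q Tb r J Y t j) volume a b := by
  refine (intervalIntegrable_const (c := C * 1 * Q.real Set.univ)).mono_fun
    (hJ.measurable_discountedWeight r hY j).aestronglyMeasurable ?_
  refine (ae_restrict_mem measurableSet_uIoc).mono fun t ht => ?_
  rw [Set.uIoc_of_le hab] at ht
  refine le_trans ?_ (le_abs_self _)
  refine norm_integral_le_of_norm_le_const (Filter.Eventually.of_forall fun ω => ?_)
  refine abs_mul_stoppedDiscount_mul_le hr hC (ha.trans ht.1.le) (abs_ite_le_one _ _)

theorem IsCTMC.measurable_stoppedDiscount_coe (hJ : IsCTMC F Q Tb G J) (r : Fin n → ℝ)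
    {u : ℝ≥0} (hu : u ≤ Tb) : Measurable[F u] (stoppedDiscount r J Tb u) := by
  have h : stoppedDiscount r J Tb u = discount r J u :=
    funext fun ω => (discount_eq_stoppedDiscount r J hu ω).symm
  rw [h]
  exact hJ.measurable_discount r hu

/-- Expand D_t = D_s - ∫ r(J_u) D_u du, keeping the indicator at time t, and exchange the integrals.
The Markov property at u then carries the state from u to t under G alone. No regularity in t of the
weights is needed beyond integrability. -/
theorem IsCTMC.discountedWeight_eq [IsFiniteMeasure Q] (hJ : IsCTMC F Q Tb G J)
    (hr : ∀ i, 0 ≤ r i) {s : ℝ≥0}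
    {Y : Ω → ℝ} (hY : Measurable[F s] Y) {C : ℝ} (hC : ∀ ω, |Y ω| ≤ C) {t : ℝ≥0}
    (hst : s ≤ t) (ht : t ≤ Tb) (j : Fin n) :
    discountedWeight Q Tb r J Y t j =
      ∑ k, discountedWeight Q Tb r J Y s k * NormedSpace.exp (((t : ℝ) - s) • G) k j
      - ∫ u in (s : ℝ)..t, ∑ k, discountedWeight Q Tb r J Y u k * r k *
          NormedSpace.exp (((t : ℝ) - u) • G) k j := by
  have hm : ∀ s ≤ Tb, Measurable (J s) := fun s hs => hJ.measurable hs
  have hK := measurable_stoppedPath hm hJ.right_cont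
  have hD := measurable_stoppedDiscount hm hJ.right_cont r
  have hYm : Measurable Y := hY.mono (F.le s) le_rfl
  have hst' : (s : ℝ) ≤ t := NNReal.coe_le_coe.2 hst
  obtain ⟨B, hB0, hB⟩ := exists_abs_le r
  set I : Ω → ℝ := fun ω => if J t ω = j then 1 else 0 with hI
  have hIm : Measurable I :=
    (measurable_of_finite fun i : Fin n => if i = j then (1 : ℝ) else 0).comp (hm t ht)
  set H : ℝ → Ω → ℝ := fun u ω =>
    Y ω * stoppedDiscount r J Tb u ω * (r (stoppedPath J Tb u ω) * I ω) with hH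
  have hHm : Measurable (Function.uncurry H) :=
    ((hYm.comp measurable_snd).mul hD).mul
      (((measurable_of_finite r).comp hK).mul (hIm.comp measurable_snd))
  have hHint : Integrable (Function.uncurry H)
      ((volume.restrict (Set.uIoc (s : ℝ) t)).prod Q) := by
    rw [Set.uIoc_of_le hst']
    refine Integrable.of_bound hHm.aestronglyMeasurable (C * (B * 1)) ?_
    have hmem : ∀ᵐ p ∂((volume.restrict (Set.Ioc (s : ℝ) t)).prod Q),
        p.1 ∈ Set.Ioc (s : ℝ) t :=
      Measure.quasiMeasurePreserving_fst.ae (ae_restrict_mem measurableSet_Ioc)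
    refine hmem.mono fun p hp => ?_
    refine abs_mul_stoppedDiscount_mul_le hr hC (s.coe_nonneg.trans hp.1.le) ?_
    rw [abs_mul]
    exact mul_le_mul (hB _) (abs_ite_le_one _ _) (abs_nonneg _) hB0
  have hswap := intervalIntegral_integral_swap hHint
  have hfirst : Integrable (fun ω => Y ω * stoppedDiscount r J Tb s ω * I ω) Q :=
    Integrable.of_bound ((hYm.mul (hD.comp measurable_prodMk_left)).mul
      hIm).aestronglyMeasurable (C * 1) (Filter.Eventually.of_forall fun ω =>
        abs_mul_stoppedDiscount_mul_le hr hC s.coe_nonneg (abs_ite_le_one _ _))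
  have hsecond : Integrable (fun ω => ∫ u in (s : ℝ)..t, H u ω) Q := by
    simp only [intervalIntegral.integral_of_le hst']
    rw [Set.uIoc_of_le hst'] at hHint
    exact hHint.integral_prod_right
  -- Used with u = s and c = 1 for the first term, and with c = r for the integrand.
  have hmarkov (u : ℝ≥0) (hsu : s ≤ u) (hut : u ≤ t) (c : Fin n → ℝ) :
      ∫ ω, Y ω * stoppedDiscount r J Tb u ω * (c (stoppedPath J Tb u ω) * I ω) ∂Q =
        ∑ k, discountedWeight Q Tb r J Y u k * c k *
          NormedSpace.exp (((t : ℝ) - u) • G) k j := by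
    have huT := hut.trans ht
    obtain ⟨c', -, hc'⟩ := exists_abs_le c
    have hY' : Measurable[F u] fun ω => Y ω * stoppedDiscount r J Tb u ω * c (J u ω) :=
      ((hY.mono (F.mono hsu) le_rfl).mul (hJ.measurable_stoppedDiscount_coe r huT)).mul
        ((measurable_of_finite c).comp (hJ.adapted u huT))
    have hmk := hJ.integral_mul_indicator hut ht hY' (C := C * c')
      (fun ω => abs_mul_stoppedDiscount_mul_le hr hC u.coe_nonneg (hc' _)) j
    calc _ = ∫ ω, Y ω * stoppedDiscount r J Tb u ω * c (J u ω) *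
          (if J t ω = j then 1 else 0) ∂Q := by
          refine integral_congr_ae (Filter.Eventually.of_forall fun ω => ?_)
          simp only [hI]
          rw [stoppedPath_coe J huT, mul_assoc _ (c _)]
      _ = _ := by
          rw [hmk]
          refine Finset.sum_congr rfl fun k _ => ?_
          congr 1
          rw [discountedWeight, ← integral_mul_const]
          refine integral_congr_ae (Filter.Eventually.of_forall fun ω => ?_)
          simp only [stoppedPath_coe J huT]
          split_ifs with h
          · rw [h]; ring
          · simp
  calc discountedWeight Q Tb r J Y t j
      = ∫ ω, (Y ω * stoppedDiscount r J Tb s ω * I ω - ∫ u in (s : ℝ)..t, H u ω) ∂Q := by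
        refine integral_congr_ae (Filter.Eventually.of_forall fun ω => ?_)
        simp only [hH, hI]
        rw [stoppedPath_coe J ht, stoppedDiscount_eq_sub_integral hm hJ.right_cont r ω s t,
          mul_sub, sub_mul, mul_assoc (Y ω) (∫ _ in _.._, _), ← intervalIntegral.integral_mul_const,
          ← intervalIntegral.integral_const_mul]
        congr 1
        refine intervalIntegral.integral_congr fun u _ => ?_
        ring
    _ = ∫ ω, Y ω * stoppedDiscount r J Tb s ω * I ω ∂Q - ∫ u in (s : ℝ)..t, ∫ ω, H u ω ∂Q := by
        rw [integral_sub hfirst hsecond, hswap]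
    _ = _ := by
        congr 1
        · simpa using hmarkov s le_rfl hst (fun _ => 1)
        · refine intervalIntegral.integral_congr fun u hu => ?_
          rw [Set.uIcc_of_le hst'] at hu
          lift u to ℝ≥0 using s.coe_nonneg.trans hu.1
          exact hmarkov u (NNReal.coe_le_coe.1 hu.1) (NNReal.coe_le_coe.1 hu.2) r

theorem IsCTMC.discountedWeight_eq_exp [IsFiniteMeasure Q] (hJ : IsCTMC F Q Tb G J)
    (hr : ∀ i, 0 ≤ r i) {s : ℝ≥0}
    {Y : Ω → ℝ} (hY : Measurable[F s] Y) {C : ℝ} (hC : ∀ ω, |Y ω| ≤ C) {t : ℝ≥0}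
    (hst : s ≤ t) (ht : t ≤ Tb) (j : Fin n) :
    discountedWeight Q Tb r J Y t j =
      ∑ k, discountedWeight Q Tb r J Y s k *
        NormedSpace.exp (((t : ℝ) - s) • (G - Matrix.diagonal r)) k j := by
  have hYm : Measurable Y := hY.mono (F.le s) le_rfl
  have h := matrix_eq_exp_of_variation_of_constants (G := G) (R := Matrix.diagonal r)
    -- The weights form a row vector; repeating it in every row gives a square matrix.
    (V := fun u => Matrix.of fun _ k => discountedWeight Q Tb r J Y u k)
    (a := s) (b := Tb)
    (fun _ k => hJ.intervalIntegrable_discountedWeight hr hYm hC k s.coe_nonneg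
      (NNReal.coe_le_coe.2 (hst.trans ht)))
    (fun u hu i k => by
      lift u to ℝ≥0 using s.coe_nonneg.trans hu.1
      rw [Matrix.of_apply, hJ.discountedWeight_eq hr hY hC (NNReal.coe_le_coe.1 hu.1)
        (NNReal.coe_le_coe.1 hu.2) k, Matrix.mul_apply]
      congr 1
      refine intervalIntegral.integral_congr fun x _ => ?_
      simp only [Matrix.mul_apply (M := _ * _), Matrix.mul_diagonal, Matrix.of_apply])
    t ⟨NNReal.coe_le_coe.2 hst, NNReal.coe_le_coe.2 ht⟩
  have h' := congrFun (congrFun h j) j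
  rw [Matrix.mul_apply] at h'
  exact h'

theorem IsCTMC.integral_eq_sum_discountedWeight [IsFiniteMeasure Q] (hJ : IsCTMC F Q Tb G J)
    (hr : ∀ i, 0 ≤ r i)
    {Y : Ω → ℝ} (hY : Measurable Y) {C : ℝ} (hC : ∀ ω, |Y ω| ≤ C) {t : ℝ≥0}
    (ht : t ≤ Tb) (f : Fin n → ℝ) :
    ∫ ω, Y ω * discount r J t ω * f (J t ω) ∂Q =
      ∑ k, discountedWeight Q Tb r J Y t k * f k := by
  have hm : ∀ s ≤ Tb, Measurable (J s) := fun s hs => hJ.measurable hs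
  have hK := measurable_stoppedPath hm hJ.right_cont
  have hD := measurable_stoppedDiscount hm hJ.right_cont r
  simp only [discountedWeight, ← integral_mul_const]
  rw [← integral_finsetSum]
  · refine integral_congr_ae (Filter.Eventually.of_forall fun ω => ?_)
    simp [discount_eq_stoppedDiscount r J ht ω, stoppedPath_coe J ht]
  · intro k _
    refine Integrable.mul_const (Integrable.of_bound (((hY.mul (hD.comp
      measurable_prodMk_left)).mul ((measurable_of_finite fun i : Fin n =>
        if i = k then (1 : ℝ) else 0).comp (hK.comp
          measurable_prodMk_left))).aestronglyMeasurable) (C * 1)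
        (Filter.Eventually.of_forall fun ω =>
          abs_mul_stoppedDiscount_mul_le hr hC t.coe_nonneg (abs_ite_le_one _ _))) _

/-- The Feynman–Kac formula: `E[D_t f(J_t) | F_s] = D_s (e^{(t-s)(G-R)} f)(J_s)`, tested against
bounded `F s`-measurable weights. -/
theorem IsCTMC.feynman_kac [IsFiniteMeasure Q] (hJ : IsCTMC F Q Tb G J)
    (hr : ∀ i, 0 ≤ r i) {s t : ℝ≥0}
    {Y : Ω → ℝ} (hY : Measurable[F s] Y) {C : ℝ} (hC : ∀ ω, |Y ω| ≤ C)
    (hst : s ≤ t) (ht : t ≤ Tb) (f : Fin n → ℝ) :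
    ∫ ω, Y ω * discount r J t ω * f (J t ω) ∂Q =
      ∫ ω, Y ω * discount r J s ω *
        (NormedSpace.exp (((t : ℝ) - s) • (G - Matrix.diagonal r)) *ᵥ f) (J s ω) ∂Q := by
  have hYm : Measurable Y := hY.mono (F.le s) le_rfl
  rw [hJ.integral_eq_sum_discountedWeight hr hYm hC ht,
    hJ.integral_eq_sum_discountedWeight hr hYm hC (hst.trans ht)]
  simp only [hJ.discountedWeight_eq_exp hr hY hC hst ht, Matrix.mulVec, dotProduct,
    Finset.sum_mul, Finset.mul_sum]
  rw [Finset.sum_comm]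
  exact Finset.sum_congr rfl fun k _ => Finset.sum_congr rfl fun j _ => by ring

end FeynmanKac

/-! ### Positivity of the state probabilities -/

section Occupation

variable {Ω : Type*} {m : MeasurableSpace Ω} {F : Filtration ℝ≥0 m} {Q : Measure Ω}
  {Tb : ℝ≥0} {n : ℕ} {G : Matrix (Fin n) (Fin n) ℝ} {J : ℝ≥0 → Ω → Fin n}

/-- At interior times an irreducible chain visits every state with positive probability. -/
theorem IsCTMC.measure_preimage_ne_zero [IsProbabilityMeasure Q] (hJ : IsCTMC F Q Tb G J)
    (hG : IsGeneratorMatrix G) (hirr : IsIrreducibleGenerator G) {t : ℝ≥0} (h0 : 0 < t)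
    (ht : t < Tb) (i : Fin n) : Q (J t ⁻¹' {i}) ≠ 0 := by
  let q : ℝ≥0 → Fin n → ℝ := fun u k => ∫ ω, (if J u ω = k then (1 : ℝ) else 0) ∂Q
  have hqnn (u : ℝ≥0) (k : Fin n) : 0 ≤ q u k :=
    integral_nonneg fun ω => by dsimp only; split_ifs <;> simp
  have hq (u : ℝ≥0) (hu : u ≤ Tb) (j : Fin n) :
      q u j = ∑ k, q 0 k * NormedSpace.exp ((u : ℝ) • G) k j := by
    have := hJ.integral_mul_indicator (u := 0) (t := u) u.2 hu
      (Y := fun _ => 1) measurable_const (C := 1) (fun _ => by simp) j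
    simpa using this
  have hderiv (j : Fin n) : HasDerivAt
      (fun u : ℝ => ∑ k, q 0 k * NormedSpace.exp (u • G) k j) (∑ l, q t l * G l j) t := by
    have h1 (k : Fin n) : HasDerivAt (fun u : ℝ => NormedSpace.exp (u • G) k j)
        (∑ l, NormedSpace.exp ((t : ℝ) • G) k l * G l j) t := by
      have := hasDerivAt_exp_smul_mulVec G (Pi.single j 1) k t
      simp only [Matrix.mulVec_single_one, Matrix.col_apply] at this
      exact this
    have h2 := HasDerivAt.fun_sum (u := Finset.univ) fun k _ => (h1 k).const_mul (q 0 k)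
    refine h2.congr_deriv ?_
    simp only [hq t ht.le, Finset.mul_sum, Finset.sum_mul]
    rw [Finset.sum_comm]
    exact Finset.sum_congr rfl fun k _ => Finset.sum_congr rfl fun l _ => by ring
  intro hi
  have hzero : ∀ j, q t j = 0 := by
    refine hirr.eq_zero_of_backward_closed (i := i) ?_ fun a b hab hb => ?_
    · refine integral_eq_zero_of_ae ?_
      have : ∀ᵐ ω ∂Q, ω ∉ J t ⁻¹' {i} := measure_eq_zero_iff_ae_notMem.1 hi
      filter_upwards [this] with ω hω
      exact if_neg hω
    -- A nonnegative function vanishing at the interior time t has a local minimum there, so its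
    -- derivative, the sum of q t l * G l b, is zero. The terms are nonnegative, hence q t a = 0
    -- whenever G a b > 0.
    · have hmin : IsLocalMin (fun u : ℝ => ∑ k, q 0 k * NormedSpace.exp (u • G) k b) t := by
        have hmem : Set.Ioo (0 : ℝ) Tb ∈ 𝓝 (t : ℝ) := Ioo_mem_nhds h0 ht
        filter_upwards [hmem] with u hu
        lift u to ℝ≥0 using hu.1.le
        rw [← hq t ht.le, ← hq u (NNReal.coe_le_coe.1 hu.2.le), hb]
        exact hqnn u b
      have hsum := hmin.hasDerivAt_eq_zero (hderiv b)
      have hterm := (Finset.sum_eq_zero_iff_of_nonneg fun l _ => ?_).1 hsum a (Finset.mem_univ _)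
      · exact (mul_eq_zero.1 hterm).resolve_right hab.ne'
      · rcases eq_or_ne l b with rfl | hlb
        · rw [hb, zero_mul]
        · exact mul_nonneg (hqnn t l) (hG.nonneg_off_diag l b hlb)
  have hone : ∑ j, q t j = 1 := by
    simp only [q]
    rw [← integral_finsetSum]
    · simp
    · intro k _
      exact Integrable.of_bound ((measurable_of_finite fun i : Fin n =>
        if i = k then (1 : ℝ) else 0).comp (hJ.measurable ht.le)).aestronglyMeasurable 1
        (Filter.Eventually.of_forall fun ω => abs_ite_le_one _ _)
  rw [Finset.sum_eq_zero fun j _ => hzero j] at hone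
  exact zero_ne_one hone

end Occupation

/-! ### Recovery densities, uniqueness and the chain under P -/

section Density

variable {Ω : Type*} {m : MeasurableSpace Ω} {F : Filtration ℝ≥0 m} {Q P : Measure Ω}
  {Tb : ℝ≥0} {n : ℕ} {G : Matrix (Fin n) (Fin n) ℝ} {J : ℝ≥0 → Ω → Fin n} {r : Fin n → ℝ}

theorem HasDensityOn.trim_eq {T : ℝ≥0} {Z : Ω → ℝ} (h : HasDensityOn F T Q P Z) :
    P.trim (F.le T) = (Q.withDensity fun ω => ENNReal.ofReal (Z ω)).trim (F.le T) := by
  refine @Measure.ext Ω (F T) _ _ fun A hA => ?_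
  rw [trim_measurableSet_eq _ hA, trim_measurableSet_eq _ hA, h.2 A hA,
    withDensity_apply _ (F.le T A hA)]

theorem HasDensityOn.lintegral_eq {T : ℝ≥0} {Z : Ω → ℝ} (h : HasDensityOn F T Q P Z)
    {X : Ω → ℝ≥0∞} (hX : Measurable[F T] X) :
    ∫⁻ ω, X ω ∂P = ∫⁻ ω, ENNReal.ofReal (Z ω) * X ω ∂Q := by
  rw [← lintegral_trim (F.le T) hX, h.trim_eq, lintegral_trim (F.le T) hX,
    lintegral_withDensity_eq_lintegral_mul _ (h.1.mono (F.le T) le_rfl).ennreal_ofReal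
      (hX.mono (F.le T) le_rfl)]
  rfl

theorem HasDensityOn.integral_eq {T : ℝ≥0} {Z : Ω → ℝ} (h : HasDensityOn F T Q P Z)
    (hZ : ∀ ω, 0 ≤ Z ω) {Y : Ω → ℝ} (hY : Measurable[F T] Y) :
    ∫ ω, Y ω ∂P = ∫ ω, Y ω * Z ω ∂Q := by
  rw [integral_trim (F.le T) hY.stronglyMeasurable, h.trim_eq,
    ← integral_trim (F.le T) hY.stronglyMeasurable,
    integral_withDensity_eq_integral_toReal_smul
      (h.1.mono (F.le T) le_rfl).ennreal_ofReal (by simp)]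
  refine integral_congr_ae (Filter.Eventually.of_forall fun ω => ?_)
  simp only [ENNReal.toReal_ofReal (hZ ω), smul_eq_mul, mul_comm]

theorem setIntegral_eq_integral_indicator_one_mul {A : Set Ω} (hA : MeasurableSet A)
    (g : Ω → ℝ) : ∫ ω in A, g ω ∂Q = ∫ ω, A.indicator (fun _ => (1 : ℝ)) ω * g ω ∂Q := by
  rw [← integral_indicator hA]
  refine integral_congr_ae (Filter.Eventually.of_forall fun ω => ?_)
  by_cases h : ω ∈ A <;> simp [h]

theorem abs_indicator_one_le (A : Set Ω) (ω : Ω) : |A.indicator (fun _ => (1 : ℝ)) ω| ≤ 1 := by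
  by_cases h : ω ∈ A <;> simp [h]

/-- Separates a weight known at time 0, the discount factor and a terminal payoff, the shape to
which Feynman–Kac applies. -/
theorem recoveryDensity_eq (c : ℝ) (f : Fin n → ℝ) (T : ℝ≥0) (ω : Ω) :
    recoveryDensity r J c f T ω =
      Real.exp (-(c * T)) * ((f (J 0 ω))⁻¹ * discount r J T ω * f (J T ω)) := by
  rw [recoveryDensity, discount, sub_eq_add_neg, Real.exp_add]
  ring

theorem recoveryDensity_pos (c : ℝ) {f : Fin n → ℝ} (hf : ∀ i, 0 < f i) (T : ℝ≥0) (ω : Ω) :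
    0 < recoveryDensity r J c f T ω :=
  mul_pos (Real.exp_pos _) (div_pos (hf _) (hf _))

theorem recoveryDensity_zero (c : ℝ) {f : Fin n → ℝ} (hf : ∀ i, 0 < f i) (ω : Ω) :
    recoveryDensity r J c f 0 ω = 1 := by
  simp [recoveryDensity, div_self (hf _).ne']

theorem IsCTMC.measurable_recoveryDensity (hJ : IsCTMC F Q Tb G J) (r : Fin n → ℝ) (c : ℝ)
    (f : Fin n → ℝ) {T : ℝ≥0} (hT : T ≤ Tb) : Measurable[F T] (recoveryDensity r J c f T) := by
  have h : recoveryDensity r J c f T = fun ω =>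
      Real.exp (-(c * T)) * ((f (J 0 ω))⁻¹ * discount r J T ω * f (J T ω)) :=
    funext fun ω => recoveryDensity_eq c f T ω
  rw [h]
  exact ((((measurable_of_finite fun i => (f i)⁻¹).comp (hJ.measurable_of_le T.2 hT)).mul
    (hJ.measurable_discount r hT)).mul
      ((measurable_of_finite f).comp (hJ.adapted T hT))).const_mul _

theorem IsCTMC.integrable_recoveryDensity [IsFiniteMeasure Q] (hJ : IsCTMC F Q Tb G J)
    (hr : ∀ i, 0 ≤ r i) (c : ℝ) (f : Fin n → ℝ) {T : ℝ≥0} (hT : T ≤ Tb) :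
    Integrable (recoveryDensity r J c f T) Q := by
  obtain ⟨B, -, hB⟩ := exists_abs_le f
  obtain ⟨C, -, hC⟩ := exists_abs_le fun i => (f i)⁻¹
  refine Integrable.of_bound ((hJ.measurable_recoveryDensity r c f hT).mono (F.le T)
    le_rfl).aestronglyMeasurable (Real.exp (-(c * T)) * (C * B))
    (Filter.Eventually.of_forall fun ω => ?_)
  rw [recoveryDensity_eq, Real.norm_eq_abs, abs_mul, abs_of_pos (Real.exp_pos _),
    discount_eq_stoppedDiscount r J hT]
  exact mul_le_mul_of_nonneg_left (abs_mul_stoppedDiscount_mul_le hr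
    (Y := fun ω => (f (J 0 ω))⁻¹) (fun _ => hC _) T.coe_nonneg (hB _)) (Real.exp_pos _).le

/-- Here f need not be an eigenvector. Taking g = 1 serves both the martingale property and the
derivation of the eigenvector equation; g = 1_j gives the transition probabilities under P. -/
theorem IsCTMC.integral_mul_recoveryDensity [IsFiniteMeasure Q] (hJ : IsCTMC F Q Tb G J)
    (hr : ∀ i, 0 ≤ r i) (c : ℝ) {f : Fin n → ℝ} (hf : ∀ i, 0 < f i) {s t : ℝ≥0} (hst : s ≤ t)
    (ht : t ≤ Tb) {Y : Ω → ℝ} (hY : Measurable[F s] Y) {C : ℝ} (hC : ∀ ω, |Y ω| ≤ C)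
    (g : Fin n → ℝ) :
    ∫ ω, Y ω * g (J t ω) * recoveryDensity r J c f t ω ∂Q =
      ∫ ω, Y ω * (Real.exp (-(c * ((t : ℝ) - s))) *
        (NormedSpace.exp (((t : ℝ) - s) • (G - Matrix.diagonal r)) *ᵥ
          fun i => f i * g i) (J s ω) / f (J s ω)) * recoveryDensity r J c f s ω ∂Q := by
  obtain ⟨B, -, hB⟩ := exists_abs_le fun i => (f i)⁻¹
  have hY' : Measurable[F s] fun ω => Y ω * (f (J 0 ω))⁻¹ :=
    hY.mul ((measurable_of_finite fun i => (f i)⁻¹).comp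
      (hJ.measurable_of_le s.2 (hst.trans ht)))
  have hC' (ω : Ω) : |Y ω * (f (J 0 ω))⁻¹| ≤ C * B := by
    rw [abs_mul]
    exact mul_le_mul (hC ω) (hB _) (abs_nonneg _) ((abs_nonneg _).trans (hC ω))
  have h := hJ.feynman_kac hr hY' hC' hst ht fun i => f i * g i
  calc _ = Real.exp (-(c * t)) * ∫ ω, Y ω * (f (J 0 ω))⁻¹ * discount r J t ω *
        (f (J t ω) * g (J t ω)) ∂Q := by
        rw [← integral_const_mul]
        refine integral_congr_ae (Filter.Eventually.of_forall fun ω => ?_)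
        simp only [recoveryDensity_eq]
        ring
    _ = _ := by
        rw [h, ← integral_const_mul]
        refine integral_congr_ae (Filter.Eventually.of_forall fun ω => ?_)
        have he : Real.exp (-(c * t)) =
            Real.exp (-(c * ((t : ℝ) - s))) * Real.exp (-(c * s)) := by
          rw [← Real.exp_add]; congr 1; ring
        simp only [recoveryDensity_eq, he]
        have := (hf (J s ω)).ne'
        field_simp

/-- The recovery density of an eigenvector is a martingale. -/
theorem IsCTMC.integral_mul_recoveryDensity_eq [IsFiniteMeasure Q] (hJ : IsCTMC F Q Tb G J)
    (hr : ∀ i, 0 ≤ r i) {c : ℝ} {f : Fin n → ℝ} (hf : ∀ i, 0 < f i)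
    (hfe : (G - Matrix.diagonal r) *ᵥ f = c • f) {s t : ℝ≥0} (hst : s ≤ t)
    (ht : t ≤ Tb) {Y : Ω → ℝ} (hY : Measurable[F s] Y) {C : ℝ} (hC : ∀ ω, |Y ω| ≤ C) :
    ∫ ω, Y ω * recoveryDensity r J c f t ω ∂Q = ∫ ω, Y ω * recoveryDensity r J c f s ω ∂Q := by
  have h := hJ.integral_mul_recoveryDensity hr c hf hst ht hY hC fun _ => 1
  simp only [mul_one] at h
  rw [h]
  refine integral_congr_ae (Filter.Eventually.of_forall fun ω => ?_)
  simp only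
  rw [exp_smul_mulVec_of_eigenvector hfe, Pi.smul_apply, smul_eq_mul, ← mul_assoc, ← Real.exp_add,
    neg_add_cancel, Real.exp_zero, one_mul, div_self (hf _).ne', mul_one]

theorem IsCTMC.hasDensityOn_withDensity [IsFiniteMeasure Q] (hJ : IsCTMC F Q Tb G J)
    (hr : ∀ i, 0 ≤ r i) {c : ℝ} {f : Fin n → ℝ} (hf : ∀ i, 0 < f i)
    (hfe : (G - Matrix.diagonal r) *ᵥ f = c • f) {T : ℝ≥0} (hT : T ≤ Tb) :
    HasDensityOn F T Q (Q.withDensity fun ω => ENNReal.ofReal (recoveryDensity r J c f Tb ω))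
      (recoveryDensity r J c f T) := by
  refine ⟨hJ.measurable_recoveryDensity r c f hT, fun A hA => ?_⟩
  have hA' := F.le T A hA
  have hpos (t : ℝ≥0) : 0 ≤ᵐ[Q.restrict A] recoveryDensity r J c f t :=
    Filter.Eventually.of_forall fun ω => (recoveryDensity_pos c hf t ω).le
  rw [withDensity_apply _ hA',
    ← ofReal_integral_eq_lintegral_ofReal
      (hJ.integrable_recoveryDensity hr c f le_rfl).restrict (hpos Tb),
    ← ofReal_integral_eq_lintegral_ofReal
      (hJ.integrable_recoveryDensity hr c f hT).restrict (hpos T),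
    setIntegral_eq_integral_indicator_one_mul hA', setIntegral_eq_integral_indicator_one_mul hA',
    hJ.integral_mul_recoveryDensity_eq hr hf hfe hT le_rfl
      (measurable_const.indicator hA) (abs_indicator_one_le A)]

theorem IsCTMC.isRealWorldMeasure_withDensity [IsProbabilityMeasure Q] (hJ : IsCTMC F Q Tb G J)
    (hr : ∀ i, 0 ≤ r i) {c : ℝ} {f : Fin n → ℝ} (hf : ∀ i, 0 < f i)
    (hfe : (G - Matrix.diagonal r) *ᵥ f = c • f) :
    IsRealWorldMeasure F Tb Q
      (Q.withDensity fun ω => ENNReal.ofReal (recoveryDensity r J c f Tb ω)) r J where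
  isProbability := ⟨by
    -- The total mass is read off on F_0, where the density is 1.
    rw [(hJ.hasDensityOn_withDensity hr hf hfe zero_le).2 _ MeasurableSet.univ]
    simp [recoveryDensity_zero c hf]⟩
  equivalent A hA := by
    have hm := ((hJ.measurable_recoveryDensity r c f le_rfl).mono (F.le Tb) le_rfl).ennreal_ofReal
    rw [withDensity_apply_eq_zero hm]
    have : {x | ENNReal.ofReal (recoveryDensity r J c f Tb x) ≠ 0} = Set.univ :=
      Set.eq_univ_of_forall fun ω => by
        simpa using recoveryDensity_pos c hf Tb ω
    rw [this, Set.univ_inter]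
  transition_independent := by
    have hmS (t : ℝ≥0) (ht : t ≤ Tb) : Measurable[F t] fun ω =>
        Real.exp (- -c * t) * ((f (J t ω))⁻¹ / (f (J 0 ω))⁻¹) :=
      (((measurable_of_finite fun i => (f i)⁻¹).comp (hJ.adapted t ht)).div
        ((measurable_of_finite fun i => (f i)⁻¹).comp
          (hJ.measurable_of_le t.2 ht))).const_mul _
    -- With δ = -c and h = 1/f, the product of density and kernel is the discount factor.
    refine ⟨-c, fun i => (f i)⁻¹, fun i => inv_pos.2 (hf i), hmS, fun t _ ω =>
      mul_pos (Real.exp_pos _) (div_pos (inv_pos.2 (hf _)) (inv_pos.2 (hf _))), fun ω => ?_,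
      fun T hT X hX => ?_⟩
    · simp [(hf (J 0 ω)).ne']
    · refine Eq.trans ?_ ((hJ.hasDensityOn_withDensity hr hf hfe hT).lintegral_eq
        ((hmS T hT).ennreal_ofReal.mul hX)).symm
      refine lintegral_congr fun ω => ?_
      rw [Pi.mul_apply]
      rw [← mul_assoc, ← ENNReal.ofReal_mul (recoveryDensity_pos c hf T ω).le,
        recoveryDensity_eq]
      congr 2
      have h1 := (hf (J T ω)).ne'
      have h2 := (hf (J 0 ω)).ne'
      have h3 : Real.exp (-(c * T)) * Real.exp (- -c * T) = 1 := by
        rw [← Real.exp_add]; simp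
      calc discount r J T ω
          = (Real.exp (-(c * T)) * Real.exp (- -c * T)) * discount r J T ω := by rw [h3, one_mul]
        _ = _ := by field_simp

/-- Pricing the claim 1_A / S_T gives P(A) = E^Q[(D_T / S_T) 1_A]. -/
theorem IsPricingKernel.hasDensityOn (hJ : IsCTMC F Q Tb G J) {δ : ℝ} {h : Fin n → ℝ}
    (hh : ∀ i, 0 < h i)
    (hS : IsPricingKernel F Tb Q P r J
      (fun t ω => Real.exp (-δ * t) * (h (J t ω) / h (J 0 ω)))) {T : ℝ≥0} (hT : T ≤ Tb) :
    HasDensityOn F T Q P (recoveryDensity r J (-δ) (fun i => (h i)⁻¹) T) := by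
  refine ⟨hJ.measurable_recoveryDensity r _ _ hT, fun A hA => ?_⟩
  have hA' := F.le T A hA
  set S : Ω → ℝ := fun ω => Real.exp (-δ * T) * (h (J T ω) / h (J 0 ω)) with hSdef
  have hSpos : ∀ ω, 0 < S ω := hS.pos T hT
  have hX : Measurable[F T] (A.indicator fun ω => ENNReal.ofReal (S ω)⁻¹) :=
    ((hS.adapted T hT).inv.ennreal_ofReal).indicator hA
  have hp := hS.price T hT _ hX
  have hR : ∫⁻ ω, ENNReal.ofReal (S ω) * A.indicator (fun ω => ENNReal.ofReal (S ω)⁻¹) ω ∂P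
      = P A := by
    rw [← lintegral_indicator_one hA']
    refine lintegral_congr fun ω => ?_
    by_cases hω : ω ∈ A
    · simp only [Set.indicator_of_mem hω, Pi.one_apply]
      rw [← ENNReal.ofReal_mul (hSpos ω).le, mul_inv_cancel₀ (hSpos ω).ne', ENNReal.ofReal_one]
    · simp [hω]
  rw [← hR, ← hp, ← lintegral_indicator hA']
  refine lintegral_congr fun ω => ?_
  by_cases hω : ω ∈ A
  · simp only [Set.indicator_of_mem hω]
    rw [← ENNReal.ofReal_mul (by exact (Real.exp_pos _).le), recoveryDensity_eq]
    congr 1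
    have h1 := (hh (J T ω)).ne'
    have h2 := (hh (J 0 ω)).ne'
    have h3 : Real.exp (-(-δ * T)) = (Real.exp (-δ * T))⁻¹ := Real.exp_neg _
    rw [h3]
    simp only [hSdef]
    have h4 := (Real.exp_pos (-δ * T)).ne'
    field_simp
  · simp [hω]

/-- The densities at s and s + u give the event {J_s = i} the same P-mass. By Feynman–Kac the two
expressions differ by the factor e^{-cu} (e^{u(G-R)} f)_i / f_i. The mass is positive, so this
factor is 1; differentiate at u = 0. -/
theorem IsCTMC.eigenvector_of_hasDensityOn [IsProbabilityMeasure Q] (hJ : IsCTMC F Q Tb G J)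
    (hG : IsGeneratorMatrix G) (hirr : IsIrreducibleGenerator G)
    (hr : ∀ i, 0 ≤ r i) (hTb : 0 < Tb) {c : ℝ} {f : Fin n → ℝ} (hf : ∀ i, 0 < f i)
    (hP : ∀ T ≤ Tb, HasDensityOn F T Q P (recoveryDensity r J c f T)) :
    (G - Matrix.diagonal r) *ᵥ f = c • f := by
  -- The midpoint is interior, so every state is charged, and it leaves room for u in [0, Tb/2].
  have hs0 : 0 < Tb / 2 := half_pos hTb
  have hsT : Tb / 2 < Tb := half_lt_self hTb
  set s := Tb / 2
  have hnn (t : ℝ≥0) (ω : Ω) : 0 ≤ recoveryDensity r J c f t ω :=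
    (recoveryDensity_pos c hf t ω).le
  funext i
  have hA : MeasurableSet[F s] (J s ⁻¹' {i}) :=
    hJ.adapted s hsT.le (measurableSet_singleton i)
  have hA' := F.le s _ hA
  set Y : Ω → ℝ := (J s ⁻¹' {i}).indicator (fun _ => (1 : ℝ)) with hYdef
  have hY : Measurable[F s] Y := measurable_const.indicator hA
  have hpos : 0 < ∫ ω, Y ω * recoveryDensity r J c f s ω ∂Q := by
    rw [hYdef, ← setIntegral_eq_integral_indicator_one_mul hA',
      setIntegral_pos_iff_support_of_nonneg_ae
        (Filter.Eventually.of_forall fun ω => hnn s ω)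
        (hJ.integrable_recoveryDensity hr c f hsT.le).integrableOn]
    have : Function.support (recoveryDensity r J c f s) = Set.univ :=
      Set.eq_univ_of_forall fun ω => (recoveryDensity_pos c hf s ω).ne'
    rw [this, Set.univ_inter]
    exact pos_iff_ne_zero.2 (hJ.measure_preimage_ne_zero hG hirr hs0 hsT i)
  have hkey : ∀ u ∈ Set.Icc (0 : ℝ) s,
      (NormedSpace.exp (u • (G - Matrix.diagonal r)) *ᵥ f) i = Real.exp (c * u) * f i := by
    intro u hu
    lift u to ℝ≥0 using hu.1
    have hut : s + u ≤ Tb := by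
      rw [← add_halves Tb]
      exact add_le_add_right (NNReal.coe_le_coe.1 hu.2) _
    have h1 := hJ.integral_mul_recoveryDensity hr c hf (le_self_add (a := s) (b := u)) hut hY
      (abs_indicator_one_le _) fun _ => 1
    have h2 := (hP (s + u) hut).integral_eq (hnn _) (hY.mono (F.mono le_self_add) le_rfl)
    rw [(hP s hsT.le).integral_eq (hnn _) hY] at h2
    simp only [mul_one, NNReal.coe_add, add_sub_cancel_left] at h1
    rw [← h2] at h1
    set b := Real.exp (-(c * u)) *
      (NormedSpace.exp ((u : ℝ) • (G - Matrix.diagonal r)) *ᵥ f) i / f i with hb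
    have h3 : ∫ ω, Y ω * recoveryDensity r J c f s ω ∂Q =
        b * ∫ ω, Y ω * recoveryDensity r J c f s ω ∂Q := by
      conv_lhs => rw [h1]
      rw [← integral_const_mul]
      refine integral_congr_ae (Filter.Eventually.of_forall fun ω => ?_)
      by_cases hω : J s ω = i
      · simp only [hω, hb]
        ring
      · have : Y ω = 0 := Set.indicator_of_notMem (s := J s ⁻¹' {i}) hω _
        simp [this]
    have hb1 : b = 1 := by
      have := mul_right_cancel₀ hpos.ne' ((one_mul _).trans h3)
      exact this.symm
    rw [hb, div_eq_one_iff_eq (hf i).ne', Real.exp_neg,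
      inv_mul_eq_iff_eq_mul₀ (Real.exp_pos _).ne'] at hb1
    exact hb1
  have hs0' : (0 : ℝ) < s := hs0
  have hd1 := (hasDerivAt_exp_smul_mulVec (G - Matrix.diagonal r) f i 0).hasDerivWithinAt
    (s := Set.Icc (0 : ℝ) s)
  have hd2 : HasDerivWithinAt (fun u : ℝ => Real.exp (c * u) * f i) (c * f i)
      (Set.Icc (0 : ℝ) s) 0 := by
    have := ((((hasDerivAt_id (0 : ℝ)).const_mul c).exp).mul_const (f i)).hasDerivWithinAt
      (s := Set.Icc (0 : ℝ) s)
    simpa using this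
  have hd3 := hd2.congr hkey (hkey 0 ⟨le_rfl, hs0'.le⟩)
  -- The identity is known only for u ≥ 0, so one-sided derivatives at the endpoint are compared.
  have huniq := (uniqueDiffOn_Icc hs0' 0 ⟨le_rfl, hs0'.le⟩).eq_deriv _ hd1 hd3
  simpa using huniq

theorem recoveryDensity_const_mul {c k : ℝ} (hk : k ≠ 0) (f : Fin n → ℝ) (T : ℝ≥0) :
    recoveryDensity r J c (fun i => k * f i) T = recoveryDensity r J c f T := by
  funext ω
  rw [recoveryDensity, recoveryDensity, mul_div_mul_left _ _ hk]

theorem IsRealWorldMeasure.hasDensityOn [IsProbabilityMeasure Q] (hJ : IsCTMC F Q Tb G J)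
    (hG : IsGeneratorMatrix G) (hirr : IsIrreducibleGenerator G) (hr : ∀ i, 0 ≤ r i)
    {c : ℝ} {f : Fin n → ℝ} (hf : ∀ i, 0 < f i)
    (hfe : (G - Matrix.diagonal r) *ᵥ f = c • f) (hP : IsRealWorldMeasure F Tb Q P r J)
    {T : ℝ≥0} (hT : T ≤ Tb) : HasDensityOn F T Q P (recoveryDensity r J c f T) := by
  obtain ⟨δ, h, hh, hS⟩ := hP.transition_independent
  have hinv : ∀ i, 0 < (h i)⁻¹ := fun i => inv_pos.2 (hh i)
  have hd : ∀ T ≤ Tb, HasDensityOn F T Q P (recoveryDensity r J (-δ) (fun i => (h i)⁻¹) T) :=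
    fun T hT => hS.hasDensityOn hJ hh hT
  -- A horizon of length zero yields no eigenvector equation, but then T = 0 and both densities are
  -- 1.
  rcases eq_or_lt_of_le (zero_le : 0 ≤ Tb) with h0 | h0
  · have hT0 : T = 0 := le_antisymm (hT.trans h0.ge) zero_le
    subst hT0
    have : recoveryDensity r J c f 0 = recoveryDensity r J (-δ) (fun i => (h i)⁻¹) 0 :=
      funext fun ω => by rw [recoveryDensity_zero c hf, recoveryDensity_zero (-δ) hinv]
    rw [this]
    exact hd 0 hT
  · obtain ⟨ω⟩ : Nonempty Ω := nonempty_of_isProbabilityMeasure Q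
    have he := hJ.eigenvector_of_hasDensityOn hG hirr hr h0 hinv hd
    obtain ⟨hc, k, hk⟩ := hG.positive_eigenvector_unique hirr hinv hf hfe he (J 0 ω)
    have hk0 : k ≠ 0 := by
      rintro rfl
      have := hk (J 0 ω)
      rw [zero_mul] at this
      exact (hinv _).ne' this
    have := hd T hT
    rwa [hc, funext hk, recoveryDensity_const_mul hk0] at this

/-- Path properties do not involve the measure. For the transitions, both sides are integrated over
A in F_s, moved to Q by the densities at s and t, and compared through Feynman–Kac with payoff f ·
1_j. -/
theorem IsCTMC.of_hasDensityOn [IsFiniteMeasure Q] [IsFiniteMeasure P] (hJ : IsCTMC F Q Tb G J)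
    (hr : ∀ i, 0 ≤ r i) {c : ℝ} {f : Fin n → ℝ} (hf : ∀ i, 0 < f i)
    (hfe : (G - Matrix.diagonal r) *ᵥ f = c • f)
    (hP : ∀ T ≤ Tb, HasDensityOn F T Q P (recoveryDensity r J c f T)) :
    IsCTMC F P Tb (recoveredGenerator G f) J where
  adapted := hJ.adapted
  right_cont := hJ.right_cont
  left_lim := hJ.left_lim
  transition s t hst ht j := by
    have hsT := hst.trans ht
    have hnn (t : ℝ≥0) (ω : Ω) : 0 ≤ recoveryDensity r J c f t ω :=
      (recoveryDensity_pos c hf t ω).le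
    set M := NormedSpace.exp (((t : ℝ) - s) • recoveredGenerator G f) with hM
    set I : Fin n → ℝ := fun i => if i = j then 1 else 0 with hI
    have hind : (J t ⁻¹' {j}).indicator (fun _ => (1 : ℝ)) = fun ω => I (J t ω) := by
      funext ω
      by_cases h : J t ω = j <;> simp [h, hI]
    have hIm : Measurable[F t] fun ω => I (J t ω) :=
      (measurable_of_finite I).comp (hJ.adapted t ht)
    have hgm : Measurable[F s] fun ω => M (J s ω) j :=
      (measurable_of_finite fun i => M i j).comp (hJ.adapted s hsT)
    have hgi : Integrable (fun ω => M (J s ω) j) P := by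
      obtain ⟨B, -, hB⟩ := exists_abs_le fun i => M i j
      exact Integrable.of_bound (hgm.mono (F.le s) le_rfl).aestronglyMeasurable B
        (Filter.Eventually.of_forall fun ω => hB _)
    rw [hind]
    symm
    refine ae_eq_condExp_of_forall_setIntegral_eq (F.le s) ?_ (fun A _ _ => hgi.integrableOn)
      (fun A hA _ => ?_) hgm.stronglyMeasurable.aestronglyMeasurable
    · exact Integrable.of_bound (hIm.mono (F.le t) le_rfl).aestronglyMeasurable 1
        (Filter.Eventually.of_forall fun ω => abs_ite_le_one _ _)
    · have hA' := F.le s A hA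
      have hY : Measurable[F s] (A.indicator fun _ => (1 : ℝ)) := measurable_const.indicator hA
      rw [setIntegral_eq_integral_indicator_one_mul hA',
        setIntegral_eq_integral_indicator_one_mul hA']
      refine ((hP s hsT).integral_eq (hnn s) (hY.mul hgm)).trans (Eq.trans ?_
        ((hP t ht).integral_eq (hnn t) ((hY.mono (F.mono hst) le_rfl).mul hIm)).symm)
      simp only [Pi.mul_apply]
      rw [hJ.integral_mul_recoveryDensity hr c hf hst ht hY (abs_indicator_one_le A) I]
      refine integral_congr_ae (Filter.Eventually.of_forall fun ω => ?_)
      have hv (A : Matrix (Fin n) (Fin n) ℝ) (i : Fin n) :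
          (A *ᵥ fun k => f k * I k) i = A i j * f j := by
        simp [Matrix.mulVec, dotProduct, hI]
      simp only
      rw [hv, hM, exp_smul_recoveredGenerator hf hfe]
      ring

end Density

theorem proposition3 {Ω : Type*} {m : MeasurableSpace Ω}
    (F : Filtration ℝ≥0 m) (Tb : ℝ≥0) (Q : Measure Ω) [IsProbabilityMeasure Q]
    {n : ℕ} (G : Matrix (Fin n) (Fin n) ℝ) (hG : IsGeneratorMatrix G)
    (hirr : IsIrreducibleGenerator G)
    (r : Fin n → ℝ) (hr : ∀ i, 0 ≤ r i)
    (J : ℝ≥0 → Ω → Fin n) (hJ : IsCTMC F Q Tb G J)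
    (ρ : ℝ) (hρ : ρ < 0) (π : Fin n → ℝ) (hπ : ∀ i, 0 < π i)
    (heig : (G - Matrix.diagonal r) *ᵥ π = ρ • π) :
    IsRealWorldMeasure F Tb Q
        (Q.withDensity fun ω => ENNReal.ofReal (recoveryDensity r J ρ π Tb ω)) r J ∧
      IsGeneratorMatrix (recoveredGenerator G π) ∧
      IsIrreducibleGenerator (recoveredGenerator G π) ∧
      ∀ P : Measure Ω, IsRealWorldMeasure F Tb Q P r J →
        (∀ T ≤ Tb, HasDensityOn F T Q P (recoveryDensity r J ρ π T)) ∧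
        IsCTMC F P Tb (recoveredGenerator G π) J := by
  refine ⟨hJ.isRealWorldMeasure_withDensity hr hπ heig, hG.recoveredGenerator hπ,
    hirr.recoveredGenerator hG hπ, fun P hP => ?_⟩
  have hd : ∀ T ≤ Tb, HasDensityOn F T Q P (recoveryDensity r J ρ π T) :=
    fun T hT => hP.hasDensityOn hJ hG hirr hr hπ heig hT
  have := hP.isProbability
  exact ⟨hd, hJ.of_hasDensityOn hr hπ heig hd⟩
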